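/- All graphs are finite and simple, and are counted up to isomorphism. A graph $G$ is $r$-critical if $\chi(G)=r$ and every proper subgraph of $G$ has chromatic number less than $r$. A vertex is simplicial if it is adjacent to all other vertices of the graph; adding $s$ simplicial vertices to a graph $H$ means forming the join $H\vee K_s$. For every $r\ge 6$ there are exactly twenty-two $r$-critical graphs on $r+4$ vertices. Moreover, there is a list of twenty-two pairwise non-isomorphic graphs, not depending on $r$, consisting of the unique $3$-critical graph on $7$ vertices, four $4$-critical graphs on $8$ vertices, sixteen $5$-critical graphs on $9$ vertices and one $6$-critical graph on $10$ vertices, such that for every $r\ge 6$ a graph on $r+4$ vertices is $r$-critical if and only if it is obtained from a $k$-critical graph of the list ($3\le k\le 6$) by adding $r-k\ge 0$ simplicial vertices. -/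

import Mathlib

/-- `G` is `r`-critical: its chromatic number is `r`, and every proper subgraph (fewer vertices or
fewer edges) has chromatic number less than `r`. -/
def IsCritical {V : Type*} (r : ℕ) (G : SimpleGraph V) : Prop :=
  G.chromaticNumber = r ∧ ∀ H : G.Subgraph, H ≠ ⊤ → H.coe.chromaticNumber < r

/-- The join of two vertex-disjoint graphs: their disjoint sum together with all edges between
the two vertex sets. -/
def graphJoin {V W : Type*} (G : SimpleGraph V) (H : SimpleGraph W) : SimpleGraph (V ⊕ W) :=
  (G ⊕g H) ⊔ completeBipartiteGraph V W

/-- The graph obtained from `G` by adding `s` new simplicial vertices, that is, vertices adjacent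
to all other vertices of the resulting graph. -/
def addSimplicial {V : Type*} (G : SimpleGraph V) (s : ℕ) : SimpleGraph (V ⊕ Fin s) :=
  graphJoin G (⊤ : SimpleGraph (Fin s))

/-- Isomorphism of graphs. -/
def AreIso {V W : Type*} (G : SimpleGraph V) (H : SimpleGraph W) : Prop :=
  Nonempty (G ≃g H)

/-- Isomorphism as an equivalence relation on the graphs with vertex set `Fin n`. -/
def isoSetoid (n : ℕ) : Setoid (SimpleGraph (Fin n)) where
  r G H := AreIso G H
  iseqv := ⟨fun _ => ⟨SimpleGraph.Iso.refl⟩, fun ⟨f⟩ => ⟨f.symm⟩, fun ⟨f⟩ ⟨g⟩ => ⟨f.trans g⟩⟩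

/-- The number of `r`-critical graphs on `n` vertices, up to isomorphism. -/
noncomputable def numCritical (r n : ℕ) : ℕ :=
  {q : Quotient (isoSetoid n) | ∃ G : SimpleGraph (Fin n),
    IsCritical r G ∧ Quotient.mk (isoSetoid n) G = q}.ncard

/-!
Simplicial vertices split off as a join with a complete graph, and a join is critical if and only if
both factors are, so it suffices to classify the critical graphs without simplicial vertices.
By Gallai's theorem an `r`-critical graph with connected complement has at least `2r - 1` vertices,
and in case of equality the complement has a perfect matching after the deletion of any vertex.
Hence a `k`-critical graph without simplicial vertices has at least `k + 2` vertices, with equality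
only for the 5-cycle. With `r + 4` vertices this leaves `r ≤ 5` if the complement is connected, and
otherwise the join of two 5-cycles.

The remaining graphs have 7, 8 or 9 vertices. Around a vertex of small degree they are divided into
independent classes, and a search that branches on the undecided pairs of a cheapest colouring shows
that each of them contains one of the listed graphs; a critical graph containing a graph of the same
order and chromatic number is equal to it.
-/

/-- Partial colourings: `ColorableOn G X m` says that the subgraph of `G` induced on `X` has a
proper colouring with `m` colours. A colouring is a function on all vertices, of which only the
values on `X` matter. -/
def ColorableOn {V : Type*} (G : SimpleGraph V) (X : Set V) (m : ℕ) : Prop :=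
  ∃ c : V → ℕ, (∀ u ∈ X, c u < m) ∧ ∀ u ∈ X, ∀ v ∈ X, G.Adj u v → c u ≠ c v

/-- `(m + 1)`-criticality in terms of colourings: `G` is not `m`-colourable, but it becomes
`m`-colourable when a vertex or an edge is deleted. -/
structure MinNonColorable {V : Type*} (G : SimpleGraph V) (m : ℕ) : Prop where
  not_colorable : ¬ G.Colorable m
  erase_vertex : ∀ v, ColorableOn G {v}ᶜ m
  erase_edge : ∀ u v, G.Adj u v → (G.deleteEdges {s(u, v)}).Colorable m

section Coloring

variable {V W : Type*} {G : SimpleGraph V} {H : SimpleGraph W} {X Y : Set V} {Z : Set W} {m k : ℕ}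

theorem deleteEdges_singleton_adj {a b u v : V} :
    (G.deleteEdges {s(u, v)}).Adj a b ↔
      G.Adj a b ∧ ¬ (a = u ∧ b = v) ∧ ¬ (a = v ∧ b = u) := by
  simp

theorem ColorableOn.comap (h : ColorableOn G X m) (f : W → V) (hf : Set.MapsTo f Z X)
    (hadj : ∀ u ∈ Z, ∀ v ∈ Z, H.Adj u v → G.Adj (f u) (f v)) : ColorableOn H Z m := by
  obtain ⟨c, hc, hp⟩ := h
  exact ⟨c ∘ f, fun u hu ↦ hc _ (hf hu),
    fun u hu v hv huv ↦ hp _ (hf hu) _ (hf hv) (hadj u hu v hv huv)⟩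

theorem ColorableOn.mono (h : ColorableOn G X m) (hY : Y ⊆ X) (hm : m ≤ k) :
    ColorableOn G Y k := by
  obtain ⟨c, hc, hp⟩ := h
  exact ⟨c, fun u hu ↦ (hc u (hY hu)).trans_le hm, fun u hu v hv ↦ hp u (hY hu) v (hY hv)⟩

theorem colorableOn_univ : ColorableOn G Set.univ m ↔ G.Colorable m := by
  rw [SimpleGraph.colorable_iff_exists_bdd_nat_coloring]
  constructor
  · rintro ⟨c, hc, hp⟩
    exact ⟨.mk c fun {u v} ↦ hp u trivial v trivial, fun v ↦ hc v trivial⟩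
  · rintro ⟨c, hc⟩
    exact ⟨c, fun u _ ↦ hc u, fun u _ v _ ↦ c.valid⟩

theorem ColorableOn.colorable_of_hom (h : ColorableOn G X m) (f : H →g G) (hf : ∀ w, f w ∈ X) :
    H.Colorable m :=
  colorableOn_univ.1 (h.comap f (fun w _ ↦ hf w) fun _ _ _ _ ↦ f.map_adj)

theorem colorableOn_image_iff (f : H ↪g G) : ColorableOn G (f '' Z) m ↔ ColorableOn H Z m := by
  refine ⟨fun h ↦ h.comap f (Set.mapsTo_image f Z) fun _ _ _ _ ↦ f.map_adj_iff.2, ?_⟩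
  rintro ⟨c, hc, hp⟩
  refine ⟨Function.extend f c 0, ?_, ?_⟩
  · rintro _ ⟨u, hu, rfl⟩
    simpa only [f.injective.extend_apply] using hc u hu
  · rintro _ ⟨u, hu, rfl⟩ _ ⟨v, hv, rfl⟩ huv
    simpa only [f.injective.extend_apply] using hp u hu v hv (f.map_adj_iff.1 huv)

theorem colorable_induce_iff : (G.induce X).Colorable m ↔ ColorableOn G X m := by
  rw [← colorableOn_univ, ← colorableOn_image_iff (SimpleGraph.Embedding.induce X),
    Set.image_univ]
  exact iff_of_eq (congrArg (ColorableOn G · m) Subtype.range_val)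

theorem ColorableOn.exists_succ_and_not (h : ColorableOn G X m) (hX : X.Nonempty) :
    ∃ p, ColorableOn G X (p + 1) ∧ ¬ ColorableOn G X p := by
  induction m with
  | zero =>
    obtain ⟨x, hx⟩ := hX
    obtain ⟨c, hc, -⟩ := h
    exact absurd (hc x hx) (Nat.not_lt_zero _)
  | succ m ih => exact (em (ColorableOn G X m)).elim ih fun hm ↦ ⟨m, h, hm⟩

theorem ColorableOn.union (hX : ColorableOn G X m) (hY : ColorableOn G Y k) :
    ColorableOn G (X ∪ Y) (m + k) := by
  classical
  obtain ⟨c, hc, hp⟩ := hX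
  obtain ⟨d, hd, hq⟩ := hY
  exact ⟨fun v ↦ if v ∈ X then c v else m + d v, by grind, by grind⟩

theorem colorableOn_empty : ColorableOn G ∅ 0 := ⟨0, by simp, by simp⟩

theorem colorableOn_one_of_isIndepSet (h : G.IsIndepSet X) : ColorableOn G X 1 :=
  ⟨0, by simp, fun _ hu _ hv huv ↦ (h hu hv huv.ne huv).elim⟩

theorem colorableOn_card_palette (c : V → ℕ) (s : Finset ℕ) (hc : ∀ u ∈ X, c u ∈ s)
    (hp : ∀ u ∈ X, ∀ v ∈ X, G.Adj u v → c u ≠ c v) : ColorableOn G X s.card := by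
  classical
  refine ⟨fun v ↦ if h : c v ∈ s then s.equivFin ⟨c v, h⟩ else 0, fun u hu ↦ by simp [hc u hu],
    fun u hu v hv huv h ↦ hp u hu v hv huv ?_⟩
  simpa [hc u hu, hc v hv, Fin.ext_iff.symm] using h

/-- Completely joined sets use disjoint palettes. -/
theorem ColorableOn.exists_add_eq (h : ColorableOn G (X ∪ Y) m)
    (hXY : ∀ u ∈ X, ∀ v ∈ Y, G.Adj u v) :
    ∃ a b, a + b = m ∧ ColorableOn G X a ∧ ColorableOn G Y b := by
  classical
  obtain ⟨c, hc, hp⟩ := h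
  let palette := (Finset.range m).filter fun i ↦ ∃ u ∈ X, c u = i
  refine ⟨palette.card, (Finset.range m \ palette).card, ?_, ?_, ?_⟩
  · rw [add_comm, Finset.card_sdiff_add_card_eq_card (Finset.filter_subset _ _),
      Finset.card_range]
  · exact colorableOn_card_palette c _ (by grind) (by grind)
  · exact colorableOn_card_palette c _ (by grind) (by grind)

namespace MinNonColorable

theorem nonempty (h : MinNonColorable G m) : Nonempty V := by
  by_contra! hV
  exact h.not_colorable (.of_isEmpty m)

theorem colorable_succ (h : MinNonColorable G m) : G.Colorable (m + 1) := by
  obtain ⟨v⟩ := h.nonempty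
  rw [← colorableOn_univ, ← Set.compl_union_self {v}]
  exact (h.erase_vertex v).union (colorableOn_one_of_isIndepSet (by simp))

end MinNonColorable

theorem chromaticNumber_lt_succ_iff :
    G.chromaticNumber < ((m + 1 : ℕ) : ℕ∞) ↔ G.Colorable m := by
  rw [← SimpleGraph.chromaticNumber_le_iff_colorable, Nat.cast_add, Nat.cast_one]
  exact ENat.lt_add_one_iff (ENat.natCast_ne_top m)

theorem MinNonColorable.colorable_subgraph (h : MinNonColorable G m) {K : G.Subgraph}
    (hK : K ≠ ⊤) : K.coe.Colorable m := by
  by_cases hv : ∃ v, v ∉ K.verts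
  · obtain ⟨v, hv⟩ := hv
    exact (h.erase_vertex v).colorable_of_hom K.hom fun w hw ↦ hv (hw ▸ w.2)
  · obtain ⟨u, v, huv, hK⟩ : ∃ u v, G.Adj u v ∧ ¬ K.Adj u v := by
      by_contra! hadj
      exact hK (SimpleGraph.Subgraph.ext (by ext; simp_all)
        (by ext u v; exact ⟨K.adj_sub, hadj u v⟩))
    refine (h.erase_edge u v huv).of_hom ⟨Subtype.val, fun {a b} hab ↦ ?_⟩
    have hab : K.Adj a b := hab
    exact deleteEdges_singleton_adj.2 ⟨K.adj_sub hab, fun ⟨ha, hb⟩ ↦ hK (ha ▸ hb ▸ hab),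
      fun ⟨ha, hb⟩ ↦ hK (ha ▸ hb ▸ hab.symm)⟩

theorem IsCritical.colorable_subgraph (h : IsCritical (m + 1) G) {K : G.Subgraph} (hK : K ≠ ⊤) :
    K.coe.Colorable m :=
  chromaticNumber_lt_succ_iff.1 (h.2 K hK)

theorem isCritical_succ_iff : IsCritical (m + 1) G ↔ MinNonColorable G m := by
  refine ⟨fun h ↦ ⟨fun hc ↦ ?_, fun v ↦ ?_, fun u v huv ↦ ?_⟩, fun h ↦ ⟨?_, fun K hK ↦ ?_⟩⟩
  · exact (chromaticNumber_lt_succ_iff.2 hc).ne h.1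
  · rw [← colorable_induce_iff, SimpleGraph.induce_eq_coe_induce_top]
    exact h.colorable_subgraph fun hK ↦ by simpa using congrArg (v ∈ ·.verts) hK
  · let K := SimpleGraph.toSubgraph (G.deleteEdges {s(u, v)}) (G.deleteEdges_le _)
    have hK : K ≠ ⊤ := fun hK ↦ by simpa [K, huv] using congrArg (·.Adj u v) hK
    exact (h.colorable_subgraph hK).of_hom ⟨fun w ↦ ⟨w, trivial⟩, id⟩
  · exact h.colorable_succ.chromaticNumber_le.antisymm
      (not_lt.1 (chromaticNumber_lt_succ_iff.not.2 h.not_colorable))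
  · exact chromaticNumber_lt_succ_iff.2 (h.colorable_subgraph hK)

namespace MinNonColorable

theorem of_erase_edge (h : ¬ G.Colorable m) (hv : ∀ v, ∃ u, G.Adj v u)
    (he : ∀ u v, G.Adj u v → (G.deleteEdges {s(u, v)}).Colorable m) : MinNonColorable G m := by
  refine ⟨h, fun v ↦ ?_, he⟩
  obtain ⟨u, hu⟩ := hv v
  refine (colorableOn_univ.2 (he v u hu)).comap id (Set.mapsTo_univ _ _) fun a ha b hb hab ↦ ?_
  exact deleteEdges_singleton_adj.2 ⟨hab, fun h ↦ ha h.1, fun h ↦ hb h.2⟩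

theorem iso (h : MinNonColorable G m) (f : G ≃g H) : MinNonColorable H m where
  not_colorable hc := h.not_colorable (hc.of_hom f.toHom)
  erase_vertex w := (h.erase_vertex (f.symm w)).comap f.symm
    (fun u hu he ↦ hu (f.symm.injective he)) fun u _ v _ ↦ f.symm.map_adj_iff.2
  erase_edge u v huv := by
    refine (h.erase_edge _ _ (f.symm.map_adj_iff.2 huv)).of_hom ⟨f.symm, fun {a b} hab ↦ ?_⟩
    simpa only [deleteEdges_singleton_adj, f.symm.map_adj_iff, f.symm.injective.eq_iff] using hab

theorem surjective_of_hom (h : MinNonColorable G m) (hH : ¬ H.Colorable m) (f : H →g G) :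
    Function.Surjective f := by
  intro v
  by_contra! hv
  exact hH ((h.erase_vertex v).colorable_of_hom f hv)

theorem adj_of_hom (h : MinNonColorable G m) (hH : ¬ H.Colorable m) (f : H →g G)
    (hf : Function.Injective f) {a b : W} (hab : G.Adj (f a) (f b)) : H.Adj a b := by
  by_contra hn
  refine hH ((h.erase_edge _ _ hab).of_hom ⟨f, fun {x y} hxy ↦ ?_⟩)
  refine deleteEdges_singleton_adj.2 ⟨f.map_adj hxy, fun ⟨hx, hy⟩ ↦ hn ?_, fun ⟨hx, hy⟩ ↦ hn ?_⟩
  · rwa [← hf hx, ← hf hy]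
  · rw [← hf hx, ← hf hy]
    exact hxy.symm

theorem areIso_of_hom [Finite W] (hVW : Nat.card V = Nat.card W) (h : MinNonColorable G m)
    (hH : ¬ H.Colorable m) (f : H →g G) : AreIso G H := by
  have hs := h.surjective_of_hom hH f
  have := Finite.of_surjective f hs
  have hf : Function.Bijective f := (Nat.bijective_iff_surjective_and_card f).2 ⟨hs, hVW.symm⟩
  exact ⟨(⟨.ofBijective f hf, ⟨h.adj_of_hom hH f hf.1, f.map_adj⟩⟩ : H ≃g G).symm⟩

end MinNonColorable

end Coloring

section Join

variable {V W V' W' : Type*} {G : SimpleGraph V} {H : SimpleGraph W} {X Y : Set V} {m a b : ℕ}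

@[simp] theorem graphJoin_adj_inl_inl {u v : V} :
    (graphJoin G H).Adj (.inl u) (.inl v) ↔ G.Adj u v := by
  simp [graphJoin, completeBipartiteGraph]

@[simp] theorem graphJoin_adj_inr_inr {u v : W} :
    (graphJoin G H).Adj (.inr u) (.inr v) ↔ H.Adj u v := by
  simp [graphJoin, completeBipartiteGraph]

@[simp] theorem graphJoin_adj_inl_inr {u : V} {v : W} : (graphJoin G H).Adj (.inl u) (.inr v) := by
  simp [graphJoin, completeBipartiteGraph]

@[simp] theorem graphJoin_adj_inr_inl {u : V} {v : W} : (graphJoin G H).Adj (.inr v) (.inl u) :=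
  graphJoin_adj_inl_inr.symm

theorem AreIso.symm (h : AreIso G H) : AreIso H G :=
  h.map SimpleGraph.Iso.symm

theorem AreIso.trans {K : SimpleGraph V'} (h : AreIso G H) (h' : AreIso H K) : AreIso G K :=
  h.elim fun f ↦ h'.map f.trans

theorem AreIso.graphJoin {G' : SimpleGraph V'} {H' : SimpleGraph W'} (hG : AreIso G G')
    (hH : AreIso H H') : AreIso (graphJoin G H) (graphJoin G' H') := by
  obtain ⟨f⟩ := hG
  obtain ⟨g⟩ := hH
  refine ⟨⟨Equiv.sumCongr f.toEquiv g.toEquiv, ?_⟩⟩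
  rintro (u | u) (v | v) <;> simp [f.map_adj_iff, g.map_adj_iff]

theorem areIso_graphJoin_induce (hX : G.IsCompleteBetween X Xᶜ) :
    AreIso (graphJoin (G.induce X) (G.induce Xᶜ)) G := by
  classical
  refine ⟨⟨Equiv.Set.sumCompl X, ?_⟩⟩
  rintro (u | u) (v | v)
  · simp
  · simpa using hX u.2 v.2
  · simpa using (hX v.2 u.2).symm
  · simp

theorem areIso_induce_range_inl : AreIso G ((graphJoin G H).induce (Set.range Sum.inl)) :=
  ⟨⟨Equiv.ofInjective _ Sum.inl_injective, by simp⟩⟩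

theorem areIso_induce_range_inr : AreIso H ((graphJoin G H).induce (Set.range Sum.inr)) :=
  ⟨⟨Equiv.ofInjective _ Sum.inr_injective, by simp⟩⟩

theorem AreIso.minNonColorable (h : AreIso G H) (hG : MinNonColorable G m) :
    MinNonColorable H m :=
  h.elim hG.iso

theorem minNonColorable_induce_iff : MinNonColorable (G.induce X) m ↔
    ¬ ColorableOn G X m ∧ (∀ v ∈ X, ColorableOn G (X \ {v}) m) ∧
      ∀ u ∈ X, ∀ v ∈ X, G.Adj u v → ColorableOn (G.deleteEdges {s(u, v)}) X m := by
  have hdel (u v : X) : (G.induce X).deleteEdges {s(u, v)} =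
      (G.deleteEdges {s(u.1, v.1)}).induce X := by
    ext a b
    simp [Subtype.ext_iff]
  have hvert (v : X) : ColorableOn (G.induce X) {v}ᶜ m ↔ ColorableOn G (X \ {v.1}) m := by
    rw [← colorableOn_image_iff (SimpleGraph.Embedding.induce X)]
    congr! 1
    ext w
    simp [SimpleGraph.Embedding.induce, Subtype.ext_iff, and_comm]
  refine ⟨fun h ↦ ⟨colorable_induce_iff.not.1 h.1, fun v hv ↦ (hvert ⟨v, hv⟩).1 (h.2 _),
    fun u hu v hv huv ↦ ?_⟩, fun ⟨h, hv, he⟩ ↦ ⟨colorable_induce_iff.not.2 h,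
    fun v ↦ (hvert v).2 (hv v v.2), fun u v huv ↦ ?_⟩⟩
  · rw [← colorable_induce_iff, ← hdel ⟨u, hu⟩ ⟨v, hv⟩]
    exact h.3 _ _ huv
  · rw [hdel, colorable_induce_iff]
    exact he u u.2 v v.2 huv

theorem ColorableOn.deleteEdges (h : ColorableOn G X m) (s : Set (Sym2 V)) :
    ColorableOn (G.deleteEdges s) X m :=
  h.comap id (Set.mapsTo_id X) fun _ _ _ _ huv ↦ SimpleGraph.deleteEdges_le s huv

theorem ColorableOn.of_diff_singleton {x : V} (h : ColorableOn G (X \ {x}) m) :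
    ColorableOn G X (m + 1) :=
  (h.union (colorableOn_one_of_isIndepSet (X := {x}) (by simp))).mono (by simp) le_rfl

section Cover

variable (hXY : X ∪ Y = Set.univ) (hjoin : G.IsCompleteBetween X Y)
include hXY

theorem MinNonColorable.erase_vertex_left (hX : MinNonColorable (G.induce X) a)
    (hY : ColorableOn G Y (b + 1)) {v : V} (hv : v ∈ X) : ColorableOn G {v}ᶜ (a + b + 1) := by
  refine (((minNonColorable_induce_iff.1 hX).2.1 v hv).union hY).mono (fun u hu ↦ ?_) le_rfl
  exact (hXY.ge (Set.mem_univ u)).imp_left fun h ↦ ⟨h, hu⟩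

theorem MinNonColorable.erase_edge_left (hX : MinNonColorable (G.induce X) a)
    (hY : ColorableOn G Y (b + 1)) {u v : V} (hu : u ∈ X) (hv : v ∈ X) (huv : G.Adj u v) :
    (G.deleteEdges {s(u, v)}).Colorable (a + b + 1) := by
  rw [← colorableOn_univ, ← hXY]
  exact ((minNonColorable_induce_iff.1 hX).2.2 u hu v hv huv).union (hY.deleteEdges _)

/-- The ends of the deleted edge share an additional colour. -/
theorem MinNonColorable.erase_edge_between (hX : MinNonColorable (G.induce X) a)
    (hY : MinNonColorable (G.induce Y) b) {u v : V} (hu : u ∈ X) (hv : v ∈ Y) :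
    (G.deleteEdges {s(u, v)}).Colorable (a + b + 1) := by
  have hu' := ((minNonColorable_induce_iff.1 hX).2.1 u hu).deleteEdges {s(u, v)}
  have hv' := ((minNonColorable_induce_iff.1 hY).2.1 v hv).deleteEdges {s(u, v)}
  have huv : (G.deleteEdges {s(u, v)}).IsIndepSet {u, v} := by
    rintro x (rfl | rfl) y (rfl | rfl) <;> simp
  rw [← colorableOn_univ, ← hXY]
  exact ((hu'.union hv').union (colorableOn_one_of_isIndepSet huv)).mono (by grind) le_rfl

include hjoin

theorem MinNonColorable.of_induce (hX : MinNonColorable (G.induce X) a)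
    (hY : MinNonColorable (G.induce Y) b) : MinNonColorable G (a + b + 1) := by
  have hX' := colorable_induce_iff.1 hX.colorable_succ
  have hY' := colorable_induce_iff.1 hY.colorable_succ
  have hcover (v : V) : v ∈ X ∨ v ∈ Y := hXY.ge (Set.mem_univ v)
  have hYX : Y ∪ X = Set.univ := (Set.union_comm Y X).trans hXY
  have hba : b + a + 1 = a + b + 1 := by omega
  refine ⟨fun hc ↦ ?_, fun v ↦ ?_, fun u v huv ↦ ?_⟩
  · rw [← colorableOn_univ, ← hXY] at hc
    obtain ⟨p, q, hpq, hp, hq⟩ := hc.exists_add_eq hjoin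
    have hap : a < p := by
      by_contra! hle
      exact hX.not_colorable (colorable_induce_iff.2 (hp.mono subset_rfl hle))
    have hbq : b < q := by
      by_contra! hle
      exact hY.not_colorable (colorable_induce_iff.2 (hq.mono subset_rfl hle))
    omega
  · rcases hcover v with hv | hv
    · exact hX.erase_vertex_left hXY hY' hv
    · exact hba ▸ hY.erase_vertex_left hYX hX' hv
  · rcases hcover u with hu | hu <;> rcases hcover v with hv | hv
    · exact hX.erase_edge_left hXY hY' hu hv huv
    · exact hX.erase_edge_between hXY hY hu hv
    · exact hba ▸ hY.erase_edge_between hYX hX hu hv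
    · exact hba ▸ hY.erase_edge_left hYX hX' hu hv huv

/-- Here `a + 1` and `b + 1` are the chromatic numbers of the two factors. -/
theorem MinNonColorable.induce_left (h : MinNonColorable G (a + b + 1)) (hX : ¬ ColorableOn G X a)
    (hY : ¬ ColorableOn G Y b) : MinNonColorable (G.induce X) a := by
  have hle {p q : ℕ} (hpq : p + q = a + b + 1) (hq : ColorableOn G Y q) : p ≤ a := by
    by_contra! hap
    exact hY (hq.mono subset_rfl (by omega))
  refine minNonColorable_induce_iff.2 ⟨hX, fun v hv ↦ ?_, fun u hu v hv huv ↦ ?_⟩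
  · have hvY := hjoin.disjoint.notMem_of_mem_left hv
    have hc := (h.erase_vertex v).mono (Y := X \ {v} ∪ Y) (by grind) le_rfl
    obtain ⟨p, q, hpq, hp, hq⟩ := hc.exists_add_eq fun u hu w hw ↦ hjoin hu.1 hw
    exact hp.mono subset_rfl (hle hpq hq)
  · have hadj {x y} (hy : y ∈ Y) (hxy : G.Adj x y) : (G.deleteEdges {s(u, v)}).Adj x y :=
      deleteEdges_singleton_adj.2 ⟨hxy, by
        grind [hjoin.disjoint.notMem_of_mem_left hu, hjoin.disjoint.notMem_of_mem_left hv]⟩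
    have hc := colorableOn_univ.2 (h.erase_edge u v huv)
    rw [← hXY] at hc
    obtain ⟨p, q, hpq, hp, hq⟩ := hc.exists_add_eq fun x hx y hy ↦ hadj hy (hjoin hx hy)
    exact hp.mono subset_rfl
      (hle hpq (hq.comap id (Set.mapsTo_id Y) fun _ _ _ hy ↦ hadj hy))

theorem MinNonColorable.exists_induce (h : MinNonColorable G m) (hX : X.Nonempty)
    (hY : Y.Nonempty) : ∃ a b, a + b + 1 = m ∧ MinNonColorable (G.induce X) a ∧
      MinNonColorable (G.induce Y) b := by
  have hG := colorableOn_univ.2 h.colorable_succ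
  obtain ⟨a, ha, ha'⟩ := (hG.mono (Set.subset_univ X) le_rfl).exists_succ_and_not hX
  obtain ⟨b, hb, hb'⟩ := (hG.mono (Set.subset_univ Y) le_rfl).exists_succ_and_not hY
  have hlt : m < a + 1 + (b + 1) := by
    by_contra! hle
    exact h.not_colorable (colorableOn_univ.1 ((ha.union hb).mono hXY.ge hle))
  have hle : a + b + 1 ≤ m := by
    obtain ⟨x, hx⟩ := hX
    have hxY := hjoin.disjoint.notMem_of_mem_left hx
    have hc := (h.erase_vertex x).mono (Y := X \ {x} ∪ Y) (by grind) le_rfl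
    obtain ⟨p, q, hpq, hp, hq⟩ := hc.exists_add_eq fun u hu w hw ↦ hjoin hu.1 hw
    by_contra! hlt
    by_cases hpa : p + 1 ≤ a
    · exact ha' (hp.of_diff_singleton.mono subset_rfl hpa)
    · exact hb' (hq.mono subset_rfl (by omega))
  obtain rfl : m = a + b + 1 := by omega
  exact ⟨a, b, rfl, h.induce_left hXY hjoin ha' hb',
    (add_comm a b ▸ h).induce_left ((Set.union_comm Y X).trans hXY) hjoin.symm hb' ha'⟩

end Cover

theorem isCompleteBetween_range_inl_range_inr :
    (graphJoin G H).IsCompleteBetween (Set.range Sum.inl) (Set.range Sum.inr) := by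
  rintro _ ⟨u, rfl⟩ _ ⟨v, rfl⟩
  exact graphJoin_adj_inl_inr

theorem MinNonColorable.graphJoin (hG : MinNonColorable G a) (hH : MinNonColorable H b) :
    MinNonColorable (graphJoin G H) (a + b + 1) :=
  .of_induce Set.isCompl_range_inl_range_inr.sup_eq_top isCompleteBetween_range_inl_range_inr
    (areIso_induce_range_inl.minNonColorable hG) (areIso_induce_range_inr.minNonColorable hH)

theorem not_preconnected_compl_of_isCompleteBetween (hX : X.Nonempty) (hX' : Xᶜ.Nonempty)
    (hjoin : G.IsCompleteBetween X Xᶜ) : ¬ Gᶜ.Preconnected := by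
  intro h
  obtain ⟨u, hu⟩ := hX
  obtain ⟨v, hv⟩ := hX'
  obtain ⟨p⟩ := h u v
  obtain ⟨d, -, hd, hd'⟩ := p.exists_boundary_dart X hu hv
  exact d.adj.2 (hjoin hd hd')

theorem exists_isCompleteBetween_of_not_preconnected_compl (h : ¬ Gᶜ.Preconnected) :
    ∃ X : Set V, X.Nonempty ∧ Xᶜ.Nonempty ∧ G.IsCompleteBetween X Xᶜ := by
  simp only [SimpleGraph.Preconnected, not_forall] at h
  obtain ⟨u, v, huv⟩ := h
  refine ⟨{w | Gᶜ.Reachable u w}, ⟨u, .rfl⟩, ⟨v, huv⟩, fun x hx y hy ↦ ?_⟩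
  by_contra hxy
  have hne : x ≠ y := fun hxy ↦ hy (hxy ▸ hx)
  exact hy (hx.trans (SimpleGraph.Adj.reachable ⟨hne, hxy⟩))

end Join

section Simplicial

variable {V W : Type*} {G : SimpleGraph V} {H : SimpleGraph W} {m k s t : ℕ}

theorem AreIso.addSimplicial (h : AreIso G H) (s : ℕ) :
    AreIso (addSimplicial G s) (addSimplicial H s) :=
  h.graphJoin ⟨.refl⟩

theorem areIso_addSimplicial_zero : AreIso (addSimplicial G 0) G := by
  refine ⟨⟨Equiv.sumEmpty V (Fin 0), ?_⟩⟩
  rintro (u | i) (v | j)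
  · exact graphJoin_adj_inl_inl.symm
  all_goals exact Fin.elim0 ‹_›

theorem AreIso.isUniversal_iff (f : G ≃g H) {v : V} : H.IsUniversal (f v) ↔ G.IsUniversal v := by
  simp only [SimpleGraph.IsUniversal, f.surjective.forall, f.injective.ne_iff, f.map_adj_iff]

/-- The graph obtained from `G` by removing all of its simplicial vertices. -/
def core (G : SimpleGraph V) : SimpleGraph {v | ¬ G.IsUniversal v} :=
  G.induce {v | ¬ G.IsUniversal v}

theorem not_isUniversal_core (v : {v | ¬ G.IsUniversal v}) : ¬ (core G).IsUniversal v := by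
  refine fun hv ↦ v.2 fun w hvw ↦ ?_
  by_cases hw : G.IsUniversal w
  · exact (hw hvw.symm).symm
  · exact hv (w := ⟨w, hw⟩) (Subtype.coe_ne_coe.1 hvw)

theorem AreIso.core (h : AreIso G H) : AreIso (core G) (core H) := by
  obtain ⟨f⟩ := h
  exact ⟨⟨f.toEquiv.subtypeEquiv fun v ↦ (AreIso.isUniversal_iff f).not.symm, f.map_adj_iff⟩⟩

theorem not_isUniversal_addSimplicial_iff (hG : ∀ v, ¬ G.IsUniversal v) {x : V ⊕ Fin s} :
    ¬ (addSimplicial G s).IsUniversal x ↔ x ∈ Set.range Sum.inl := by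
  rcases x with v | i
  · simp only [Set.mem_range_self, iff_true]
    exact fun h ↦ hG v fun w hvw ↦ graphJoin_adj_inl_inl.1 (h (Sum.inl_injective.ne hvw))
  · simp only [Set.mem_range, reduceCtorEq, exists_false, iff_false, not_not]
    rintro (w | j) hij
    · exact graphJoin_adj_inr_inl
    · exact graphJoin_adj_inr_inr.2 fun h ↦ hij (congrArg Sum.inr h)

theorem areIso_core_addSimplicial (hG : ∀ v, ¬ G.IsUniversal v) :
    AreIso G (core (addSimplicial G s)) := by
  rw [core, Set.ext fun x ↦ not_isUniversal_addSimplicial_iff hG]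
  exact areIso_induce_range_inl

theorem AreIso.of_addSimplicial
    (h : AreIso (_root_.addSimplicial G s) (_root_.addSimplicial H t))
    (hG : ∀ v, ¬ G.IsUniversal v) (hH : ∀ w, ¬ H.IsUniversal w) : AreIso G H :=
  (areIso_core_addSimplicial hG).trans (h.core.trans (areIso_core_addSimplicial hH).symm)

theorem areIso_addSimplicial_core [Finite V] :
    AreIso G (addSimplicial (core G) (Nat.card ({v | ¬ G.IsUniversal v}ᶜ : Set V))) := by
  have htop : G.induce {v | ¬ G.IsUniversal v}ᶜ = ⊤ :=
    SimpleGraph.eq_top_iff_forall_isUniversal.2 fun v w hvw ↦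
      not_not.1 v.2 (Subtype.coe_ne_coe.2 hvw)
  refine (areIso_graphJoin_induce fun u hu v hv ↦ ?_).symm.trans (AreIso.graphJoin ⟨.refl⟩ ?_)
  · exact (not_not.1 hv fun h ↦ hv (h ▸ hu)).symm
  · exact htop ▸ ⟨.completeGraph (Finite.equivFin _)⟩

theorem graphJoin_top_top : graphJoin (⊤ : SimpleGraph V) (⊤ : SimpleGraph W) = ⊤ := by
  ext (u | u) (v | v) <;> simp

theorem minNonColorable_zero [Nonempty V] [Subsingleton V] : MinNonColorable G 0 where
  not_colorable h := not_isEmpty_of_nonempty V h.isEmpty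
  erase_vertex v := colorableOn_empty.mono (fun u hu ↦ hu (Subsingleton.elim u v)) le_rfl
  erase_edge u v huv := (huv.ne (Subsingleton.elim u v)).elim

theorem minNonColorable_top : ∀ s, MinNonColorable (⊤ : SimpleGraph (Fin (s + 1))) s
  | 0 => minNonColorable_zero (V := Fin 1)
  | s + 1 => by
    refine AreIso.minNonColorable ?_ ((minNonColorable_top s).graphJoin (minNonColorable_top 0))
    rw [graphJoin_top_top]
    exact ⟨.completeGraph finSumFinEquiv⟩

theorem MinNonColorable.eq (h : MinNonColorable G m) (h' : MinNonColorable G k) : m = k := by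
  by_contra! hne
  rcases hne.lt_or_gt with hlt | hlt
  · exact h'.not_colorable (h.colorable_succ.mono hlt)
  · exact h.not_colorable (h'.colorable_succ.mono hlt)

theorem MinNonColorable.addSimplicial (h : MinNonColorable G k) (s : ℕ) :
    MinNonColorable (addSimplicial G s) (k + s) := by
  cases s with
  | zero => exact areIso_addSimplicial_zero.symm.minNonColorable h
  | succ s => exact h.graphJoin (minNonColorable_top s)

theorem MinNonColorable.of_addSimplicial [Nonempty V]
    (h : MinNonColorable (_root_.addSimplicial G s) m) :
    ∃ k, k + s = m ∧ MinNonColorable G k := by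
  cases s with
  | zero => exact ⟨m, rfl, areIso_addSimplicial_zero.minNonColorable h⟩
  | succ s =>
    obtain ⟨a, b, hab, ha, hb⟩ := h.exists_induce (Set.isCompl_range_inl_range_inr.sup_eq_top)
      isCompleteBetween_range_inl_range_inr
      (Set.range_nonempty _) (Set.range_nonempty _)
    have hbs := (areIso_induce_range_inr.symm.minNonColorable hb).eq (minNonColorable_top s)
    exact ⟨a, by omega, areIso_induce_range_inl.symm.minNonColorable ha⟩

theorem MinNonColorable.isUniversal_of_not_cliqueFree (h : MinNonColorable G m)
    (hG : ¬ G.CliqueFree (m + 1)) (v : V) : G.IsUniversal v := by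
  have f := SimpleGraph.topEmbeddingOfNotCliqueFree hG
  have hf := h.surjective_of_hom (minNonColorable_top m).not_colorable f.toHom
  intro w hvw
  obtain ⟨i, rfl⟩ := hf v
  obtain ⟨j, rfl⟩ := hf w
  exact f.map_adj_iff.2 fun hij ↦ hvw (congrArg f hij)

theorem MinNonColorable.two_le (h : MinNonColorable G m) (hG : ∀ v, ¬ G.IsUniversal v) :
    2 ≤ m := by
  have := h.nonempty
  have hfree : G.CliqueFree (m + 1) := by
    by_contra hclique
    exact hG (Classical.arbitrary V) (h.isUniversal_of_not_cliqueFree hclique _)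
  by_contra! hm
  interval_cases m
  · exact not_isEmpty_of_nonempty V (SimpleGraph.cliqueFree_one.1 hfree)
  · exact h.not_colorable (SimpleGraph.colorable_one_iff.2 (SimpleGraph.cliqueFree_two.1 hfree))

theorem MinNonColorable.card_of_forall_isUniversal [Fintype V] (h : MinNonColorable G m)
    (hG : ∀ v, G.IsUniversal v) : Fintype.card V = m + 1 := by
  obtain rfl := SimpleGraph.eq_top_iff_forall_isUniversal.2 hG
  have := h.nonempty
  obtain ⟨n, hn⟩ := Nat.exists_eq_succ_of_ne_zero (Fintype.card_ne_zero (α := V))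
  have hiso : AreIso (⊤ : SimpleGraph V) (⊤ : SimpleGraph (Fin (n + 1))) :=
    ⟨.completeGraph (Fintype.equivFinOfCardEq hn)⟩
  rw [hn, (hiso.minNonColorable h).eq (minNonColorable_top n)]

theorem MinNonColorable.exists_core [Fintype V] (h : MinNonColorable G m)
    (hcard : Fintype.card V ≠ m + 1) :
    ∃ k s, k + s = m ∧ MinNonColorable (core G) k ∧ AreIso G (_root_.addSimplicial (core G) s) := by
  have : Nonempty {v | ¬ G.IsUniversal v} := by
    by_contra! he
    exact hcard (h.card_of_forall_isUniversal fun v ↦ by_contra fun hv ↦ he.false ⟨v, hv⟩)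
  have hiso := areIso_addSimplicial_core (G := G)
  obtain ⟨k, hk, hcore⟩ := (hiso.minNonColorable h).of_addSimplicial
  exact ⟨k, _, hk, hcore, hiso⟩

end Simplicial

/-- The complement of `G` has a perfect matching on `X`. The matching is encoded by the involution
that exchanges the two ends of each matching edge. -/
def HasCoMatching {V : Type*} (G : SimpleGraph V) (X : Finset V) : Prop :=
  ∃ f : V → V, ∀ u ∈ X, f u ∈ X ∧ f u ≠ u ∧ f (f u) = u ∧ ¬ G.Adj u (f u)

/-- A family of disjoint odd subsets of `Y`, each a union of connected components of the
complement of `G` on `Y`. -/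
structure OddParts {V : Type*} (G : SimpleGraph V) (Y : Finset V) (𝒬 : Finset (Finset V)) :
    Prop where
  subset : ∀ Q ∈ 𝒬, Q ⊆ Y
  odd : ∀ Q ∈ 𝒬, Odd Q.card
  disjoint : (𝒬 : Set (Finset V)).PairwiseDisjoint id
  adj : ∀ Q ∈ 𝒬, ∀ u ∈ Q, ∀ v ∈ Y, v ∉ Q → G.Adj u v

open scoped Classical in
/-- A decomposition of the complement of `G` as in the Gallai–Edmonds structure theorem: a
separating set `S`, factor-critical odd parts `Q ∈ 𝒬` of the rest, at least `|S|` in number, and a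
perfectly matched remainder. -/
structure GallaiEdmonds {V : Type*} [Fintype V] (G : SimpleGraph V) (S : Finset V)
    (𝒬 : Finset (Finset V)) : Prop extends OddParts G Sᶜ 𝒬 where
  card_le : S.card ≤ 𝒬.card
  erase : ∀ Q ∈ 𝒬, ∀ u ∈ Q, HasCoMatching G (Q.erase u)
  rest : HasCoMatching G (Sᶜ \ 𝒬.biUnion id)

section GallaiEdmonds

open scoped Classical

variable {V W : Type*} {G : SimpleGraph V} {X Y Z S : Finset V} {𝒬 𝒬' : Finset (Finset V)}

theorem hasCoMatching_of_isPerfectMatching {M : (Gᶜ.induce (X : Set V)).Subgraph}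
    (hM : M.IsPerfectMatching) : HasCoMatching G X := by
  rw [SimpleGraph.Subgraph.isPerfectMatching_iff] at hM
  choose g hg hu using hM
  refine ⟨fun v ↦ if h : v ∈ X then g ⟨v, h⟩ else v, fun u huX ↦ ?_⟩
  have hadj : Gᶜ.Adj u (g ⟨u, huX⟩) := M.adj_sub (hg ⟨u, huX⟩)
  have hmem : (g ⟨u, huX⟩ : V) ∈ X := (g ⟨u, huX⟩).2
  simp only [huX, dif_pos, hmem]
  exact ⟨trivial, hadj.1.symm,
    congrArg Subtype.val (hu (g ⟨u, huX⟩) ⟨u, huX⟩ (hg ⟨u, huX⟩).symm).symm, hadj.2⟩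

theorem exists_oddParts_of_embedding [Finite W] {K : SimpleGraph W} (f : K ↪g Gᶜ)
    (hY : (Y : Set V) = Set.range f) :
    ∃ 𝒬, OddParts G Y 𝒬 ∧ 𝒬.card = K.oddComponents.ncard := by
  have := Fintype.ofFinite W
  let part : K.ConnectedComponent → Finset V := fun c ↦ c.supp.toFinset.map f.toEmbedding
  have mem_part {c v} : v ∈ part c ↔ ∃ x, K.connectedComponentMk x = c ∧ f x = v := by
    simp [part]
  have part_injective : Function.Injective part := by
    intro c d hcd
    obtain ⟨x, rfl⟩ := c.exists_rep
    obtain ⟨y, rfl, hxy⟩ := mem_part.1 (hcd ▸ mem_part.2 ⟨x, rfl, rfl⟩)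
    rw [f.injective hxy]
    rfl
  have hfin : K.oddComponents.Finite := Set.toFinite _
  refine ⟨hfin.toFinset.map ⟨part, part_injective⟩, ⟨?_, ?_, ?_, ?_⟩, ?_⟩
  · simp only [Finset.mem_map, Function.Embedding.coeFn_mk]
    rintro _ ⟨c, -, rfl⟩ v hv
    obtain ⟨x, -, rfl⟩ := mem_part.1 hv
    exact Finset.mem_coe.1 (hY ▸ ⟨x, rfl⟩)
  · simp only [Finset.mem_map, Set.Finite.mem_toFinset, Function.Embedding.coeFn_mk]
    rintro _ ⟨c, hc, rfl⟩
    have hc : Odd c.supp.ncard := hc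
    rw [Set.ncard_eq_toFinset_card'] at hc
    simpa only [part, Finset.card_map] using hc
  · simp only [Finset.coe_map, Function.Embedding.coeFn_mk]
    rintro _ ⟨c, -, rfl⟩ _ ⟨d, -, rfl⟩ hne
    refine Finset.disjoint_left.2 fun v hc hd ↦ ?_
    obtain ⟨x, rfl, rfl⟩ := mem_part.1 hc
    obtain ⟨y, rfl, hxy⟩ := mem_part.1 hd
    exact hne (by rw [f.injective hxy])
  · simp only [Finset.mem_map, Function.Embedding.coeFn_mk]
    rintro _ ⟨c, -, rfl⟩ u hu v hv hvc
    obtain ⟨x, rfl, rfl⟩ := mem_part.1 hu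
    obtain ⟨y, rfl⟩ : v ∈ Set.range f := hY ▸ Finset.mem_coe.2 hv
    by_contra hadj
    have hxy : Gᶜ.Adj (f y) (f x) :=
      ⟨fun h ↦ hvc (h ▸ hu), fun h ↦ hadj h.symm⟩
    exact hvc (mem_part.2 ⟨y, SimpleGraph.ConnectedComponent.sound
      (f.map_adj_iff.1 hxy).reachable, rfl⟩)
  · rw [Finset.card_map, ← Set.ncard_eq_toFinset_card _ hfin]

theorem exists_embedding_deleteVerts (H : SimpleGraph V) (X : Set V) (U : Set X) :
    ∃ f : ((⊤ : (H.induce X).Subgraph).deleteVerts U).coe ↪g H,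
      Set.range f = X \ Subtype.val '' U := by
  refine ⟨⟨⟨fun x ↦ x.1.1, fun x y hxy ↦ Subtype.ext (Subtype.ext hxy)⟩, fun {x y} ↦
    ⟨fun hxy ↦ ?_, fun hxy ↦ ((⊤ : (H.induce X).Subgraph).deleteVerts U).adj_sub hxy⟩⟩, ?_⟩
  · exact SimpleGraph.Subgraph.deleteVerts_adj.2 ⟨trivial, x.2.2, trivial, y.2.2, hxy⟩
  · ext v
    constructor
    · rintro ⟨x, rfl⟩
      exact ⟨x.1.2, fun ⟨y, hy, hxy⟩ ↦ x.2.2 (Subtype.ext hxy ▸ hy)⟩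
    · rintro ⟨hvX, hvU⟩
      exact ⟨⟨⟨v, hvX⟩, trivial, fun hv ↦ hvU ⟨_, hv, rfl⟩⟩, rfl⟩

/-- Tutte's theorem for the complement of `G` on `X`, with the usual parity addendum. -/
theorem exists_oddParts_of_not_hasCoMatching (h : ¬ HasCoMatching G X) :
    ∃ S ⊆ X, ∃ 𝒬, OddParts G (X \ S) 𝒬 ∧ S.card < 𝒬.card ∧
      Even (𝒬.card + S.card + X.card) := by
  obtain ⟨U, hU⟩ : ∃ U, (Gᶜ.induce (X : Set V)).IsTutteViolator U := by
    by_contra! hn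
    obtain ⟨M, hM⟩ := SimpleGraph.tutte.2 hn
    exact h (hasCoMatching_of_isPerfectMatching hM)
  unfold SimpleGraph.IsTutteViolator at hU
  let S : Finset V := U.toFinset.map ⟨Subtype.val, Subtype.val_injective⟩
  have hSU : (S : Set V) = Subtype.val '' U := by simp [S]
  have hSX : S ⊆ X := Finset.coe_subset.1 (hSU ▸ Subtype.coe_image_subset _ U)
  obtain ⟨f, hf⟩ := exists_embedding_deleteVerts Gᶜ X U
  rw [← hSU, ← Finset.coe_sdiff] at hf
  obtain ⟨𝒬, h𝒬, hcard⟩ := exists_oddParts_of_embedding f hf.symm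
  rw [← hcard, ← Set.ncard_image_of_injective U Subtype.val_injective, ← hSU,
    Set.ncard_coe_finset] at hU
  have hodd := SimpleGraph.odd_ncard_oddComponents
    ((⊤ : (Gᶜ.induce (X : Set V)).Subgraph).deleteVerts U).coe
  rw [← hcard, ← Nat.card_range_of_injective f.injective, hf, Nat.card_coe_set_eq,
    Set.ncard_coe_finset] at hodd
  have := Finset.card_sdiff_add_card_eq_card hSX
  exact ⟨S, hSX, 𝒬, h𝒬, hU, by grind⟩

theorem OddParts.nonempty (h : OddParts G Y 𝒬) {Q : Finset V} (hQ : Q ∈ 𝒬) : Q.Nonempty :=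
  Finset.card_pos.1 (h.odd Q hQ).pos

/-- A part `Z` separated in the complement, and disjoint from all `Q ∈ 𝒬`, may be decomposed
separately. -/
theorem OddParts.union (h : OddParts G Y 𝒬) (h' : OddParts G (Z \ S) 𝒬')
    (hZY : Z ⊆ Y) (hSZ : S ⊆ Z) (hdisj : ∀ Q ∈ 𝒬, Disjoint Q Z)
    (hjoin : ∀ u ∈ Z, ∀ v ∈ Y, v ∉ Z → G.Adj u v) :
    OddParts G (Y \ S) (𝒬 ∪ 𝒬') ∧ (𝒬 ∪ 𝒬').card = 𝒬.card + 𝒬'.card := by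
  have hQZ : ∀ Q ∈ 𝒬', Q ⊆ Z := fun Q hQ ↦ (h'.subset Q hQ).trans Finset.sdiff_subset
  have hdisj' : ∀ Q ∈ 𝒬, ∀ Q' ∈ 𝒬', Disjoint Q Q' := fun Q hQ Q' hQ' ↦
    (hdisj Q hQ).mono_right (hQZ Q' hQ')
  refine ⟨⟨?_, ?_, ?_, ?_⟩, ?_⟩
  · rintro Q hQ v hv
    rcases Finset.mem_union.1 hQ with hQ | hQ
    · exact Finset.mem_sdiff.2 ⟨h.subset Q hQ hv,
        fun hvS ↦ Finset.disjoint_left.1 (hdisj Q hQ) hv (hSZ hvS)⟩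
    · have := Finset.mem_sdiff.1 (h'.subset Q hQ hv)
      exact Finset.mem_sdiff.2 ⟨hZY this.1, this.2⟩
  · intro Q hQ
    exact (Finset.mem_union.1 hQ).elim (h.odd Q) (h'.odd Q)
  · rw [Finset.coe_union, Set.pairwiseDisjoint_union]
    exact ⟨h.disjoint, h'.disjoint, fun Q hQ Q' hQ' _ ↦ hdisj' Q hQ Q' hQ'⟩
  · intro Q hQ u hu v hv hvQ
    obtain ⟨hvY, hvS⟩ := Finset.mem_sdiff.1 hv
    rcases Finset.mem_union.1 hQ with hQ | hQ
    · exact h.adj Q hQ u hu v hvY hvQ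
    · by_cases hvZ : v ∈ Z
      · exact h'.adj Q hQ u hu v (Finset.mem_sdiff.2 ⟨hvZ, hvS⟩) hvQ
      · exact hjoin u (hQZ Q hQ hu) v hvY hvZ
  · refine Finset.card_union_of_disjoint (Finset.disjoint_left.2 fun Q hQ hQ' ↦ ?_)
    exact (h.nonempty hQ).ne_empty (disjoint_self.1 (hdisj' Q hQ Q hQ'))

theorem OddParts.erase (h : OddParts G Y 𝒬) {Q : Finset V} (hQ : Q ∈ 𝒬) {u : V} (hu : u ∈ Q) :
    OddParts G (Y.erase u) (𝒬.erase Q) where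
  subset Q' hQ' v hv := by
    obtain ⟨hne, hQ'⟩ := Finset.mem_erase.1 hQ'
    exact Finset.mem_erase.2 ⟨fun hvu ↦
      Finset.disjoint_left.1 (h.disjoint hQ' hQ hne) hv (hvu ▸ hu), h.subset Q' hQ' hv⟩
  odd Q' hQ' := h.odd Q' (Finset.mem_of_mem_erase hQ')
  disjoint := h.disjoint.subset (Finset.coe_subset.2 (Finset.erase_subset _ _))
  adj Q' hQ' v hv w hw := h.adj Q' (Finset.mem_of_mem_erase hQ') v hv w (Finset.mem_of_mem_erase hw)

theorem OddParts.two_mul_sum_half_add_card (h : OddParts G Y 𝒬) :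
    2 * ∑ Q ∈ 𝒬, Q.card / 2 + 𝒬.card = (𝒬.biUnion id).card := by
  rw [Finset.card_biUnion h.disjoint, Finset.mul_sum, Finset.card_eq_sum_ones,
    ← Finset.sum_add_distrib]
  refine Finset.sum_congr rfl fun Q hQ ↦ ?_
  exact Nat.two_mul_div_two_add_one_of_odd (h.odd Q hQ)

section Maximal

variable [Fintype V] (h : OddParts G Sᶜ 𝒬)
  (hmax : ∀ S' 𝒬', OddParts G S'ᶜ 𝒬' → 𝒬'.card + S.card ≤ 𝒬.card + S'.card ∧
    (𝒬'.card + S.card = 𝒬.card + S'.card → S'.card ≤ S.card))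

include h hmax

theorem OddParts.hasCoMatching_erase_of_maximal {Q : Finset V} (hQ : Q ∈ 𝒬) {u : V} (hu : u ∈ Q) :
    HasCoMatching G (Q.erase u) := by
  by_contra hn
  obtain ⟨S', hS', 𝒬', h', hlt, heven⟩ := exists_oddParts_of_not_hasCoMatching hn
  have hQS := h.subset Q hQ
  obtain ⟨hunion, hcard⟩ := (h.erase hQ hu).union h' (Finset.erase_subset_erase u hQS) hS'
    (fun Q' hQ' ↦ (h.disjoint (Finset.mem_of_mem_erase hQ') hQ
      (Finset.ne_of_mem_erase hQ')).mono_right (Finset.erase_subset u Q))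
    fun v hv w hw hwQ ↦ h.adj Q hQ v (Finset.mem_of_mem_erase hv) w (Finset.mem_of_mem_erase hw)
      fun hw' ↦ hwQ (Finset.mem_erase.2 ⟨Finset.ne_of_mem_erase hw, hw'⟩)
  have hset : Sᶜ.erase u \ S' = (insert u (S ∪ S'))ᶜ := by
    ext v
    simp only [Finset.mem_sdiff, Finset.mem_erase, Finset.mem_compl, Finset.mem_insert,
      Finset.mem_union]
    tauto
  have hdisj : Disjoint S S' := Finset.disjoint_left.2 fun v hv hv' ↦
    Finset.mem_compl.1 (hQS (Finset.mem_of_mem_erase (hS' hv'))) hv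
  have hu' : u ∉ S ∪ S' := fun hu' ↦ (Finset.mem_union.1 hu').elim
    (Finset.mem_compl.1 (hQS hu)) fun hu' ↦ Finset.notMem_erase u Q (hS' hu')
  have hle := hmax _ _ (hset ▸ hunion)
  rw [hcard, Finset.card_erase_of_mem hQ, Finset.card_insert_of_notMem hu',
    Finset.card_union_of_disjoint hdisj] at hle
  rw [Finset.card_erase_of_mem hu] at heven
  have hpos := Finset.card_pos.2 ⟨Q, hQ⟩
  have hodd := h.odd Q hQ
  rw [Nat.odd_iff] at hodd
  rw [Nat.even_iff] at heven
  omega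

theorem OddParts.hasCoMatching_rest_of_maximal : HasCoMatching G (Sᶜ \ 𝒬.biUnion id) := by
  by_contra hn
  obtain ⟨S', hS', 𝒬', h', hlt, -⟩ := exists_oddParts_of_not_hasCoMatching hn
  obtain ⟨hunion, hcard⟩ := h.union h' Finset.sdiff_subset hS'
    (fun Q hQ ↦ Finset.disjoint_sdiff.mono_left (Finset.subset_biUnion_of_mem id hQ))
    (by
      intro u hu v hv hvR
      obtain ⟨Q, hQ, hvQ⟩ : ∃ Q ∈ 𝒬, v ∈ Q := by simpa [Finset.mem_compl.1 hv] using hvR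
      obtain ⟨huS, huR⟩ := Finset.mem_sdiff.1 hu
      exact (h.adj Q hQ v hvQ u huS fun huQ ↦ huR (Finset.mem_biUnion.2 ⟨Q, hQ, huQ⟩)).symm)
  have hset : Sᶜ \ S' = (S ∪ S')ᶜ := by rw [Finset.compl_union, Finset.sdiff_eq_inter_compl]
  have hdisj : Disjoint S S' := Finset.disjoint_left.2 fun v hv hv' ↦
    Finset.mem_compl.1 (Finset.mem_sdiff.1 (hS' hv')).1 hv
  have hle := hmax _ _ (hset ▸ hunion)
  rw [hcard, Finset.card_union_of_disjoint hdisj] at hle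
  omega

end Maximal

/-- The decomposition maximises `|𝒬| - |S|` and, subject to that, `|S|`. -/
theorem exists_gallaiEdmonds [Fintype V] (G : SimpleGraph V) : ∃ S 𝒬, GallaiEdmonds G S 𝒬 := by
  let barriers : Finset (Finset V × Finset (Finset V)) :=
    Finset.univ.filter fun p ↦ OddParts G p.1ᶜ p.2
  have mem_barriers {S 𝒬} : (S, 𝒬) ∈ barriers ↔ OddParts G Sᶜ 𝒬 := by simp [barriers]
  have h_empty : OddParts G (∅ᶜ : Finset V) ∅ := ⟨by simp, by simp, by simp, by simp⟩
  obtain ⟨⟨S, 𝒬⟩, hS, hlex⟩ := barriers.exists_max_image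
    (fun p ↦ toLex ((p.2.card : ℤ) - p.1.card, p.1.card)) ⟨_, mem_barriers.2 h_empty⟩
  have h := mem_barriers.1 hS
  have hmax S' 𝒬' (h' : OddParts G S'ᶜ 𝒬') : 𝒬'.card + S.card ≤ 𝒬.card + S'.card ∧
      (𝒬'.card + S.card = 𝒬.card + S'.card → S'.card ≤ S.card) := by
    have := hlex _ (mem_barriers.2 h')
    rw [Prod.Lex.toLex_le_toLex] at this
    dsimp only at this
    omega
  exact ⟨S, 𝒬, h, by simpa using hmax _ _ h_empty,
    fun Q hQ u hu ↦ h.hasCoMatching_erase_of_maximal hmax hQ hu,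
    h.hasCoMatching_rest_of_maximal hmax⟩

end GallaiEdmonds

/-- The odd set `Q` needs `(|Q| + 1) / 2` colours, the number used by the classes of a matching of
the complement and one singleton. -/
def IsTight {V : Type*} (G : SimpleGraph V) (Q : Finset V) : Prop :=
  ¬ ColorableOn G Q (Q.card / 2)

open scoped Classical in
/-- The vertices of `S` with a neighbour in `Q` in the complement of `G`. -/
noncomputable def coNeighbors {V : Type*} (G : SimpleGraph V) (S Q : Finset V) : Finset V :=
  S.filter fun s ↦ ∃ u ∈ Q, ¬ G.Adj s u

section Hall

open scoped Classical

variable {ι α : Type*}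

theorem exists_injOn_of_forall_card_le_card_biUnion [Nonempty α] {s : Finset ι} {t : ι → Finset α}
    (h : ∀ Z ⊆ s, Z.card ≤ (Z.biUnion t).card) :
    ∃ f : ι → α, Set.InjOn f s ∧ ∀ i ∈ s, f i ∈ t i := by
  obtain ⟨f, hf, hft⟩ :=
    (Finset.all_card_le_biUnion_card_iff_exists_injective fun i : s ↦ t i).1 fun Z ↦ by
      have hZ := h (Z.map (.subtype _)) (Finset.map_subtype_subset Z)
      rwa [Finset.card_map, Finset.map_eq_image, Finset.image_biUnion] at hZ
  refine ⟨fun i ↦ if hi : i ∈ s then f ⟨i, hi⟩ else Classical.arbitrary α, ?_, fun i hi ↦ ?_⟩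
  · intro i hi j hj hij
    simp only [Finset.mem_coe] at hi hj
    simpa only [hi, hj, dif_pos, hf.eq_iff, Subtype.mk.injEq] using hij
  · simpa only [hi, dif_pos] using hft ⟨i, hi⟩

/-- If Hall's condition fails, a set `Z` of maximal deficiency satisfies Hall's condition from the
other side. -/
theorem exists_injOn_or_exists_injOn_biUnion [Nonempty α] (s : Finset ι) (t : ι → Finset α) :
    (∃ f : ι → α, Set.InjOn f s ∧ ∀ i ∈ s, f i ∈ t i) ∨
      ∃ Z ⊆ s, Z.Nonempty ∧ ∃ f : α → ι, Set.InjOn f (Z.biUnion t) ∧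
        ∀ a ∈ Z.biUnion t, f a ∈ Z ∧ a ∈ t (f a) := by
  by_cases hall : ∀ Z ⊆ s, Z.card ≤ (Z.biUnion t).card
  · exact .inl (exists_injOn_of_forall_card_le_card_biUnion hall)
  push Not at hall
  obtain ⟨Z₀, hZ₀, hlt⟩ := hall
  obtain ⟨Z, hZ, hmax⟩ := s.powerset.exists_max_image
    (fun Z ↦ (Z.card : ℤ) - (Z.biUnion t).card) ⟨Z₀, Finset.mem_powerset.2 hZ₀⟩
  rw [Finset.mem_powerset] at hZ
  have hZ_ne : Z.Nonempty := by
    have := hmax Z₀ (Finset.mem_powerset.2 hZ₀)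
    exact Finset.card_pos.1 (by omega)
  have : Nonempty ι := ⟨hZ_ne.choose⟩
  obtain ⟨f, hf, hft⟩ := exists_injOn_of_forall_card_le_card_biUnion
    (s := Z.biUnion t) (t := fun a ↦ Z.filter fun i ↦ a ∈ t i) fun A hA ↦ by
    set N := A.biUnion fun a ↦ Z.filter fun i ↦ a ∈ t i
    have hN : N ⊆ Z := Finset.biUnion_subset.2 fun a _ ↦ Finset.filter_subset _ _
    have hsub : (Z \ N).biUnion t ⊆ Z.biUnion t \ A := by
      intro a ha
      obtain ⟨i, hi, hai⟩ := Finset.mem_biUnion.1 ha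
      obtain ⟨hiZ, hiN⟩ := Finset.mem_sdiff.1 hi
      exact Finset.mem_sdiff.2 ⟨Finset.mem_biUnion.2 ⟨i, hiZ, hai⟩, fun haA ↦ hiN
        (Finset.mem_biUnion.2 ⟨a, haA, Finset.mem_filter.2 ⟨hiZ, hai⟩⟩)⟩
    have hdef := hmax (Z \ N) (Finset.mem_powerset.2 (Finset.sdiff_subset.trans hZ))
    have := Finset.card_le_card hsub
    have := Finset.card_sdiff_add_card_eq_card hA
    have := Finset.card_sdiff_add_card_eq_card hN
    omega
  exact .inr ⟨Z, hZ, hZ_ne, f, hf, fun a ha ↦ Finset.mem_filter.1 (hft a ha)⟩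

end Hall

section ColoringUnion

open scoped Classical

variable {V ι : Type*} {G : SimpleGraph V}

theorem ColorableOn.biUnion {s : Finset ι} {A : ι → Set V} {w : ι → ℕ}
    (h : ∀ i ∈ s, ColorableOn G (A i) (w i)) : ColorableOn G (⋃ i ∈ s, A i) (∑ i ∈ s, w i) := by
  induction s using Finset.induction_on with
  | empty => simpa using colorableOn_empty
  | insert i s hi ih =>
    rw [Finset.sum_insert hi, Finset.set_biUnion_insert]
    exact (h i (Finset.mem_insert_self i s)).union
      (ih fun j hj ↦ h j (Finset.mem_insert_of_mem hj))

theorem ColorableOn.sum_le_of_pairwise_joined {s : Finset ι} {A : ι → Set V} {w : ι → ℕ}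
    (hw : ∀ i ∈ s, ∀ k, ColorableOn G (A i) k → w i ≤ k)
    (hA : ∀ i ∈ s, ∀ j ∈ s, i ≠ j → ∀ u ∈ A i, ∀ v ∈ A j, G.Adj u v) {k : ℕ}
    (h : ColorableOn G (⋃ i ∈ s, A i) k) : ∑ i ∈ s, w i ≤ k := by
  induction s using Finset.induction_on generalizing k with
  | empty => simp
  | insert i s hi ih =>
    rw [Finset.set_biUnion_insert] at h
    obtain ⟨a, b, rfl, ha, hb⟩ := h.exists_add_eq fun u hu v hv ↦ by
      obtain ⟨j, hj, hvj⟩ := Set.mem_iUnion₂.1 hv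
      exact hA i (Finset.mem_insert_self i s) j (Finset.mem_insert_of_mem hj)
        (fun hij ↦ hi (hij ▸ hj)) u hu v hvj
    rw [Finset.sum_insert hi]
    exact add_le_add (hw i (Finset.mem_insert_self i s) a ha)
      (ih (fun j hj ↦ hw j (Finset.mem_insert_of_mem hj))
        (fun j hj j' hj' ↦ hA j (Finset.mem_insert_of_mem hj) j' (Finset.mem_insert_of_mem hj')) hb)

theorem colorableOn_card (X : Finset V) : ColorableOn G X X.card := by
  have h := ColorableOn.biUnion (G := G) (s := X) (A := fun v ↦ {v}) (w := fun _ ↦ 1)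
    fun v _ ↦ colorableOn_one_of_isIndepSet (by simp)
  exact h.mono (fun v hv ↦ Set.mem_iUnion₂.2 ⟨v, hv, rfl⟩) (by simp)

theorem colorableOn_pair {u v : V} (h : ¬ G.Adj u v) : ColorableOn G {u, v} 1 :=
  colorableOn_one_of_isIndepSet (Set.pairwise_pair.2 fun _ ↦ ⟨h, fun h' ↦ h h'.symm⟩)

theorem HasCoMatching.exists_coloring_class_card_eq_two {X : Finset V} (h : HasCoMatching G X) :
    ∃ k, 2 * k = X.card ∧ ∃ c : V → ℕ, (∀ u ∈ X, c u < k) ∧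
      (∀ u ∈ X, ∀ w ∈ X, G.Adj u w → c u ≠ c w) ∧
      ∀ u ∈ X, (X.filter fun w ↦ c w = c u).card = 2 := by
  obtain ⟨f, hf⟩ := h
  let pair (u : V) : Finset V := {u, f u}
  let P := X.image pair
  let c (u : V) : ℕ := if hu : pair u ∈ P then P.equivFin ⟨pair u, hu⟩ else 0
  have hP {u : V} (hu : u ∈ X) : pair u ∈ P := Finset.mem_image_of_mem pair hu
  have hpair {u w : V} (hu : u ∈ X) : pair w = pair u ↔ w = u ∨ w = f u := by
    refine ⟨fun h ↦ ?_, ?_⟩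
    · have hw : w ∈ pair u := h ▸ Finset.mem_insert_self w {f w}
      simpa [pair] using hw
    · rintro (rfl | rfl)
      · rfl
      · rw [show pair (f u) = {f u, f (f u)} from rfl, (hf u hu).2.2.1, Finset.pair_comm]
  have hc {u w : V} (hu : u ∈ X) (hw : w ∈ X) : c w = c u ↔ w = u ∨ w = f u := by
    rw [← hpair hu]
    simp [c, hP hu, hP hw, ← Fin.ext_iff]
  have hfiber {u : V} (hu : u ∈ X) : (X.filter fun w ↦ w = u ∨ w = f u).card = 2 := by
    rw [← Finset.card_pair (hf u hu).2.1.symm]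
    congr 1
    ext w
    have := hf u hu
    grind
  refine ⟨P.card, ?_, c, fun u hu ↦ by simp [c, hP hu], fun u hu w hw huw h ↦ ?_, fun u hu ↦ ?_⟩
  · rw [Finset.card_eq_sum_card_image pair X, Finset.sum_const_nat (m := 2), mul_comm]
    intro Q hQ
    obtain ⟨u, hu, rfl⟩ := Finset.mem_image.1 hQ
    rw [← hfiber hu, Finset.filter_congr fun w _ ↦ hpair hu]
  · rcases (hc hw hu).1 h with rfl | rfl
    · exact huw.ne rfl
    · exact (hf w hw).2.2.2 huw.symm
  · rw [← hfiber hu, Finset.filter_congr fun w hw ↦ hc hu hw]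

theorem HasCoMatching.exists_colorableOn {X : Finset V} (h : HasCoMatching G X) :
    ∃ k, 2 * k = X.card ∧ ColorableOn G X k := by
  obtain ⟨k, hk, c, hc, hp, -⟩ := h.exists_coloring_class_card_eq_two
  exact ⟨k, hk, c, hc, hp⟩

theorem colorableOn_insert_of_hasCoMatching_erase {Q : Finset V} {s u : V} (hu : u ∈ Q)
    (h : HasCoMatching G (Q.erase u)) (hs : ¬ G.Adj s u) :
    ColorableOn G (insert s (Q : Set V)) (Q.card / 2 + 1) := by
  obtain ⟨k, hk, hc⟩ := h.exists_colorableOn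
  refine (hc.union (colorableOn_pair hs)).mono (fun v hv ↦ ?_) ?_
  · by_cases hvu : v = u <;> by_cases hvs : v = s <;> simp_all
  · rw [Finset.card_erase_of_mem hu] at hk
    omega

end ColoringUnion

section Gallai

open scoped Classical

variable {V : Type*} [Fintype V] {G : SimpleGraph V} {S : Finset V} {𝒬 : Finset (Finset V)} {m : ℕ}

theorem GallaiEdmonds.colorableOn_insert (h : GallaiEdmonds G S 𝒬) {Q : Finset V} (hQ : Q ∈ 𝒬)
    {s : V} (hs : s ∈ coNeighbors G S Q) :
    ColorableOn G (insert s (Q : Set V)) (Q.card / 2 + 1) := by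
  obtain ⟨-, u, hu, hadj⟩ := Finset.mem_filter.1 hs
  exact colorableOn_insert_of_hasCoMatching_erase hu (h.erase Q hQ u hu) hadj

theorem GallaiEdmonds.colorableOn (h : GallaiEdmonds G S 𝒬) {Q : Finset V} (hQ : Q ∈ 𝒬) :
    ColorableOn G Q (Q.card / 2 + 1) := by
  obtain ⟨u, hu⟩ := h.nonempty hQ
  exact (colorableOn_insert_of_hasCoMatching_erase hu (h.erase Q hQ u hu) (G.irrefl)).mono
    (Set.subset_insert u Q) le_rfl

/-- Each matched vertex of `S` joins a part that needs the additional colour anyway. -/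
theorem GallaiEdmonds.colorable_of_injOn (h : GallaiEdmonds G S 𝒬) {ψ : Finset V → V}
    (hψ : Set.InjOn ψ (𝒬.filter (IsTight G)))
    (hψS : ∀ Q ∈ 𝒬.filter (IsTight G), ψ Q ∈ coNeighbors G S Q)
    (hm : Fintype.card V ≤ 2 * m + 1) : G.Colorable m := by
  set 𝒯 := 𝒬.filter (IsTight G)
  have hT := ColorableOn.biUnion (s := 𝒯) fun Q hQ ↦
    h.colorableOn_insert (Finset.filter_subset _ _ hQ) (hψS Q hQ)
  have hN := ColorableOn.biUnion (s := 𝒬.filter fun Q ↦ ¬ IsTight G Q)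
    fun Q hQ ↦ not_not.1 (Finset.mem_filter.1 hQ).2
  have hS := colorableOn_card (G := G) (S \ 𝒯.image ψ)
  obtain ⟨k, hk, hR⟩ := h.rest.exists_colorableOn
  have hψ𝒯 : 𝒯.image ψ ⊆ S :=
    Finset.image_subset_iff.2 fun Q hQ ↦ (Finset.mem_filter.1 (hψS Q hQ)).1
  refine colorableOn_univ.1 ((((hT.union hN).union hS).union hR).mono (fun v _ ↦ ?_) ?_)
  · simp only [Set.mem_union, Set.mem_iUnion₂, Finset.mem_coe, Finset.mem_sdiff,
      Finset.mem_compl, Finset.mem_biUnion, Finset.mem_image, Set.mem_insert_iff, id]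
    grind
  · have hcardS := Finset.card_sdiff_add_card_eq_card hψ𝒯
    rw [Finset.card_image_of_injOn hψ] at hcardS
    have hcard𝒬 := h.two_mul_sum_half_add_card
    have hcardR := Finset.card_sdiff_add_card_eq_card (Finset.biUnion_subset.2 h.subset)
    have hcardV := Finset.card_add_card_compl S
    have hle := h.card_le
    have hsum : ∑ Q ∈ 𝒯, Q.card / 2 + ∑ Q ∈ 𝒬 with ¬ IsTight G Q, Q.card / 2 =
        ∑ Q ∈ 𝒬, Q.card / 2 := Finset.sum_filter_add_sum_filter_not _ _ _
    rw [Finset.sum_add_distrib, Finset.sum_const, smul_eq_mul, mul_one]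
    change 2 * k = (Sᶜ \ 𝒬.biUnion fun Q ↦ Q).card at hk
    change _ = (𝒬.biUnion fun Q ↦ Q).card at hcard𝒬
    omega

section Deficient

variable (h : GallaiEdmonds G S 𝒬) {Z : Finset (Finset V)} (hZ : Z ⊆ 𝒬.filter (IsTight G))
include h hZ

theorem GallaiEdmonds.colorableOn_biUnion_union {φ : V → Finset V}
    (hφ : Set.InjOn φ (Z.biUnion (coNeighbors G S)))
    (hφZ : ∀ s ∈ Z.biUnion (coNeighbors G S), φ s ∈ Z ∧ s ∈ coNeighbors G S (φ s)) :
    ColorableOn G ((⋃ Q ∈ Z, (Q : Set V)) ∪ Z.biUnion (coNeighbors G S))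
      (∑ Q ∈ Z, (Q.card / 2 + 1)) := by
  let A (Q : Finset V) : Set V := Q ∪ {s | s ∈ Z.biUnion (coNeighbors G S) ∧ φ s = Q}
  have hA : ∀ Q ∈ Z, ColorableOn G (A Q) (Q.card / 2 + 1) := by
    intro Q hQ
    have hQ𝒬 := Finset.filter_subset _ _ (hZ hQ)
    by_cases hex : ∃ s ∈ Z.biUnion (coNeighbors G S), φ s = Q
    · obtain ⟨s, hs, rfl⟩ := hex
      refine (h.colorableOn_insert hQ𝒬 (hφZ s hs).2).mono ?_ le_rfl
      rintro v (hv | ⟨hv, hvs⟩)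
      · exact .inr hv
      · exact .inl (hφ hv hs hvs)
    · refine (h.colorableOn hQ𝒬).mono ?_ le_rfl
      rintro v (hv | hv)
      · exact hv
      · exact absurd ⟨v, hv⟩ hex
  refine (ColorableOn.biUnion hA).mono ?_ le_rfl
  rintro v (hv | hv)
  · obtain ⟨Q, hQ, hvQ⟩ := Set.mem_iUnion₂.1 hv
    exact Set.mem_iUnion₂.2 ⟨Q, hQ, .inl hvQ⟩
  · exact Set.mem_iUnion₂.2 ⟨φ v, (hφZ v hv).1, .inr ⟨hv, rfl⟩⟩

theorem GallaiEdmonds.sum_le_of_colorableOn {k : ℕ} (hk : ColorableOn G (⋃ Q ∈ Z, (Q : Set V)) k) :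
    ∑ Q ∈ Z, (Q.card / 2 + 1) ≤ k := by
  refine hk.sum_le_of_pairwise_joined (fun Q hQ k hk ↦ ?_) fun Q hQ Q' hQ' hne u hu v hv ↦ ?_
  · by_contra! hlt
    exact (Finset.mem_filter.1 (hZ hQ)).2 (hk.mono subset_rfl (by omega))
  · have hQ𝒬 := Finset.filter_subset _ _ (hZ hQ)
    have hQ'𝒬 := Finset.filter_subset _ _ (hZ hQ')
    exact h.adj Q hQ𝒬 u hu v (h.subset Q' hQ'𝒬 hv)
      fun hvQ ↦ Finset.disjoint_left.1 (h.disjoint hQ𝒬 hQ'𝒬 hne) hvQ hv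

theorem GallaiEdmonds.adj_of_notMem {Q : Finset V} (hQ : Q ∈ Z) {u v : V} (hu : u ∈ Q)
    (hv : v ∉ Z.biUnion (coNeighbors G S)) (hvQ : v ∉ Q) : G.Adj u v := by
  by_cases hvS : v ∈ S
  · by_contra hadj
    exact hv (Finset.mem_biUnion.2 ⟨Q, hQ, Finset.mem_filter.2
      ⟨hvS, u, hu, fun hvu ↦ hadj hvu.symm⟩⟩)
  · exact h.adj Q (Finset.filter_subset _ _ (hZ hQ)) u hu v (Finset.mem_compl.2 hvS) hvQ

/-- In a colouring of `G - w`, the parts in `Z` share no colour with the vertices outside `T`, the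
union of their neighbourhoods, so the colours of these parts may be redistributed to include `T`. -/
theorem GallaiEdmonds.colorable_of_injOn_biUnion {φ : V → Finset V}
    (hφ : Set.InjOn φ (Z.biUnion (coNeighbors G S)))
    (hφZ : ∀ s ∈ Z.biUnion (coNeighbors G S), φ s ∈ Z ∧ s ∈ coNeighbors G S (φ s))
    {w : V} (hw : w ∈ Z.biUnion (coNeighbors G S)) (hm : ColorableOn G {w}ᶜ m) :
    G.Colorable m := by
  set T := Z.biUnion (coNeighbors G S)
  have hwS : w ∈ S := by
    obtain ⟨Q, -, hQ⟩ := Finset.mem_biUnion.1 hw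
    exact (Finset.mem_filter.1 hQ).1
  let R : Set V := {v | v ∉ T ∧ ∀ Q ∈ Z, v ∉ Q}
  have hZR : ColorableOn G ((⋃ Q ∈ Z, (Q : Set V)) ∪ R) m := by
    refine hm.mono ?_ le_rfl
    rintro v (hv | hv) rfl
    · obtain ⟨Q, hQ, hvQ⟩ := Set.mem_iUnion₂.1 hv
      exact Finset.mem_compl.1 (h.subset Q (Finset.filter_subset _ _ (hZ hQ)) hvQ) hwS
    · exact hv.1 hw
  obtain ⟨a, b, hab, ha, hb⟩ := hZR.exists_add_eq fun u hu v hv ↦ by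
    obtain ⟨Q, hQ, huQ⟩ := Set.mem_iUnion₂.1 hu
    exact h.adj_of_notMem hZ hQ huQ hv.1 (hv.2 Q hQ)
  have hle := h.sum_le_of_colorableOn hZ ha
  refine colorableOn_univ.1 (((h.colorableOn_biUnion_union hZ hφ hφZ).union hb).mono
    (fun v _ ↦ ?_) (by omega))
  by_cases hvT : v ∈ T
  · exact .inl (.inr hvT)
  · by_cases hvZ : ∃ Q ∈ Z, v ∈ Q
    · exact .inl (.inl (by simpa using hvZ))
    · exact .inr ⟨hvT, by simpa using hvZ⟩

end Deficient

/-- **Gallai's theorem.** -/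
theorem MinNonColorable.hasCoMatching_erase (h : MinNonColorable G m) (hconn : Gᶜ.Preconnected)
    (hcard : Fintype.card V ≤ 2 * m + 1) (x : V) : HasCoMatching G (Finset.univ.erase x) := by
  obtain ⟨S, 𝒬, hGE⟩ := exists_gallaiEdmonds G
  have := h.nonempty
  obtain ⟨ψ, hψ, hψS⟩ | ⟨Z, hZ, ⟨Q, hQ⟩, φ, hφ, hφZ⟩ :=
    exists_injOn_or_exists_injOn_biUnion (𝒬.filter (IsTight G)) (coNeighbors G S)
  · exact absurd (hGE.colorable_of_injOn hψ hψS hcard) h.not_colorable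
  rcases (Z.biUnion (coNeighbors G S)).eq_empty_or_nonempty with hT | ⟨w, hw⟩
  · have hQ𝒬 := Finset.filter_subset _ _ (hZ hQ)
    obtain rfl : Q = Finset.univ := by
      by_contra hne
      refine not_preconnected_compl_of_isCompleteBetween (X := (Q : Set V)) ?_ ?_ ?_ hconn
      · exact Finset.coe_nonempty.2 (hGE.nonempty hQ𝒬)
      · simpa [Set.nonempty_compl] using hne
      · exact fun u hu v hv ↦ hGE.adj_of_notMem hZ hQ hu (by simp [hT]) hv
    exact hGE.erase _ hQ𝒬 x (Finset.mem_univ x)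
  · exact absurd (hGE.colorable_of_injOn_biUnion hZ hφ hφZ hw (h.erase_vertex w)) h.not_colorable

theorem MinNonColorable.two_mul_add_one_le_card (h : MinNonColorable G m)
    (hconn : Gᶜ.Preconnected) : 2 * m + 1 ≤ Fintype.card V := by
  by_contra! hlt
  obtain ⟨x⟩ := h.nonempty
  obtain ⟨k, hk, hc⟩ := (h.hasCoMatching_erase hconn (by omega) x).exists_colorableOn
  rw [Finset.card_erase_of_mem (Finset.mem_univ x), Finset.card_univ] at hk
  rw [Finset.coe_erase, Finset.coe_univ] at hc
  have := Fintype.card_pos_iff.2 h.nonempty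
  exact h.not_colorable (colorableOn_univ.1 (hc.of_diff_singleton.mono subset_rfl (by omega)))

end Gallai

/-- A binary relation on `{0, …, 9}`, stored in the binary digits of a number: the pair `(u, v)`
sits at position `10 * u + v`. The functions on tables are evaluated by the kernel; for its sake
they are written with recursors instead of pattern matching. -/
abbrev Table := ℕ

namespace Table

/-- Right fold of a list. -/
def fold {α β : Type} (f : α → β → β) (b : β) (l : List α) : β :=
  List.rec b (fun a _ r ↦ f a r) l

/-- The conditional `if b then x else y`. -/
def sel {α : Type} (b : Bool) (x y : α) : α := Bool.rec y x b

/-- Whether `p` holds for an element of the list. -/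
def any {α : Type} (p : α → Bool) (l : List α) : Bool := fold (fun a r ↦ sel (p a) true r) false l

/-- Whether `p` holds for all elements of the list. -/
def all {α : Type} (p : α → Bool) (l : List α) : Bool := fold (fun a r ↦ sel (p a) r false) true l

/-- The set of all `v` related to `u`. Sets of vertices are stored in the binary digits of a
number below `1024`. -/
def row (N : Table) (u : ℕ) : ℕ := Nat.land (Nat.shiftRight N (Nat.mul 10 u)) 1023

/-- The table with entries `(u, v)` and `(v, u)`. -/
def edge (u v : ℕ) : Table :=
  Nat.lor (Nat.pow 2 (Nat.add (Nat.mul 10 u) v)) (Nat.pow 2 (Nat.add (Nat.mul 10 v) u))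

/-- The table of the graph with the given edges, where the edge `uv` is written as the two-digit
number `10 * u + v`. -/
def ofEdges (l : List ℕ) : Table :=
  fold (fun e N ↦ Nat.lor (edge (Nat.div e 10) (Nat.mod e 10)) N) 0 l

/-- The table of the symmetric closure of `R` on `{0, …, n - 1}`. -/
def ofRel (R : ℕ → ℕ → Bool) (n : ℕ) : Table :=
  fold (fun u N ↦ fold (fun v N ↦ sel (R u v) (Nat.lor N (edge u v)) N) N (List.range n)) 0
    (List.range n)

/-- The number of elements of a set `x < 1024`. The product contains every digit of `x` once at a
position divisible by four, and casting out fifteens adds up the hexadecimal digits. -/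
def size (x : ℕ) : ℕ :=
  Nat.mod (Nat.land (Nat.mul x 0x200040008001) 0x111111111111111) 15

/-- Whether two sets are disjoint. -/
def disjoint (x y : ℕ) : Bool := Nat.beq (Nat.land x y) 0

/-- Insertion into a list sorted by `key`. -/
def insertBy {α : Type} (key : α → ℕ) (a : α) (l : List α) : List α :=
  List.rec [a] (fun b t r ↦ sel (Nat.ble (key a) (key b)) (a :: b :: t) (b :: r)) l

/-- Insertion sort. -/
def sortBy {α : Type} (key : α → ℕ) (l : List α) : List α := fold (insertBy key) [] l

/-- The vertices in the order of decreasing degrees. -/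
def byDegree (N : Table) (vs : List ℕ) : List ℕ := sortBy (fun v ↦ Nat.sub 10 (size (row N v))) vs

/-- Whether a colouring of cost `cost` improves on the best one known, a list whose head is its
cost. -/
def better (cost : ℕ) (best : List ℕ) : Bool := List.rec true (fun a _ _ ↦ Nat.blt cost a) best

/-- Puts the vertex `b` with neighbourhood `r` in turn into each of the classes `cs` that allow it,
and continues with `next`. Joining a class costs one for every member in `u`. -/
def placeInClass (r b u : ℕ) (cs : List ℕ) :
    ℕ → (ℕ → List ℕ → List ℕ → List ℕ) → List ℕ → List ℕ :=
  List.rec (fun _ _ best ↦ best) (fun c cs ih cost next best ↦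
    ih cost (fun cost t ↦ next cost (c :: t)) (sel (disjoint r c)
      (sel (better (Nat.add cost (size (Nat.land c u))) best)
        (next (Nat.add cost (size (Nat.land c u))) (Nat.lor c b :: cs) best) best) best)) cs

/-- Branch and bound search for the colouring of `N` that has the fewest monochromatic pairs
outside of `K`, extends the classes `cs` to the vertices `vs`, and opens at most `k` new classes.
The result is the cost followed by the colour classes. -/
def bestColoring (N K : Table) (vs : List ℕ) : ℕ → ℕ → List ℕ → List ℕ → List ℕ :=
  fold (fun v ih k cost cs best ↦
    placeInClass (row N v) (Nat.pow 2 v) (Nat.xor 1023 (row K v)) cs cost (ih k)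
      (Nat.rec best
        (fun k _ ↦ sel (better cost best) (ih k cost (Nat.pow 2 v :: cs) best) best) k))
    (fun _ cost cs _ ↦ cost :: cs) vs

/-- Whether `N` is `m`-colourable. All pairs are taken to be cheap, so that the search stops at the
first colouring. -/
def colorable (N : Table) (m : ℕ) (vs : List ℕ) : Bool :=
  List.rec false (fun _ _ _ ↦ true) (bestColoring N (2 ^ 100 - 1) vs m 0 [] [])

/-- The first class that contains `v`. -/
def classOf (v : ℕ) (cs : List ℕ) : ℕ := fold (fun c r ↦ sel (disjoint (Nat.pow 2 v) c) r c) 0 cs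

/-- Whether `cs` consists of at most `m` classes that cover all vertices. -/
def isCover (m : ℕ) (vs cs : List ℕ) : Bool :=
  sel (Nat.ble cs.length m)
    (all (fun v ↦ sel (disjoint (Nat.pow 2 v) (classOf v cs)) false true) vs) false

/-- The vertices `u < v` in the class of `v` for which the pair `(u, v)` is not in `K`. -/
def openSet (K : Table) (cs : List ℕ) (v : ℕ) : ℕ :=
  Nat.land (Nat.land (classOf v cs) (Nat.xor 1023 (row K v))) (Nat.sub (Nat.pow 2 v) 1)

/-- The pairs `u < v` outside of `K` that lie in a common class. -/
def openPairs (K : Table) (cs vs : List ℕ) : List (ℕ × ℕ) :=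
  fold (fun v r ↦ fold (fun u r ↦ sel (disjoint (Nat.pow 2 u) (openSet K cs v)) r ((u, v) :: r))
    r vs) [] vs

/-- The pairs to branch on, most similar neighbourhoods first. -/
def branches (N K : Table) (cs vs : List ℕ) : List (ℕ × ℕ) :=
  sortBy (fun p ↦ size (Nat.xor (row N p.1) (row N p.2))) (openPairs K cs vs)

/-- The number of ordered triangles at `v`. -/
def triangles (N : Table) (n v : ℕ) : ℕ :=
  fold (fun u s ↦ sel (disjoint (Nat.pow 2 u) (row N v)) s
    (Nat.add (size (Nat.land (row N v) (row N u))) s)) 0 (List.range n)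

/-- The sum of the squares of the numbers of ordered triangles at the vertices. -/
def triangleSum (N : Table) (n : ℕ) : ℕ :=
  fold (fun v s ↦ Nat.add (Nat.mul (triangles N n v) (triangles N n v)) s) 0 (List.range n)

/-- Whether the partial map `f` from `F` to `N` extends to a homomorphism defined on `is` that
preserves the numbers of triangles and avoids the set `used`. -/
def extendsToHom (F N : Table) (n : ℕ) (is : List ℕ) : ℕ → List (ℕ × ℕ) → Bool :=
  fold (fun i ih used f ↦
    any (fun v ↦ sel (disjoint (Nat.pow 2 v) used)
      (sel (Nat.beq (triangles F n i) (triangles N n v))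
        (sel (all (fun p ↦ sel (Nat.testBit (row F i) p.1) (Nat.testBit (row N v) p.2) true) f)
          (ih (Nat.lor used (Nat.pow 2 v)) ((i, v) :: f)) false) false) false) (List.range n))
    (fun _ _ ↦ true) is

/-- Whether the edge `uv` of `N` can be removed without making `N` colourable. -/
def isRedundant (N : Table) (m : ℕ) (vs : List ℕ) (u v : ℕ) : Bool :=
  sel (disjoint (Nat.pow 2 u) (row N v)) false
    (sel (colorable (Nat.xor N (Nat.land N (edge u v))) m vs) false true)

/-- The test at the leaves of the search, where `N` is not `m`-colourable. If `N` is not one of the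
graphs `Fs`, then it is not critical or violates the bound on the degrees. -/
def leaf (Fs : List Table) (m d n : ℕ) (N : Table) : Bool :=
  sel (any (fun v ↦ Nat.blt (size (row N v)) d) (List.range n)) true
    (sel (any (fun F ↦ sel (Nat.beq (triangleSum F n) (triangleSum N n))
        (extendsToHom F N n (List.range n) 0 []) false) Fs) true
      ((fun vs ↦ any (fun u ↦ any (isRedundant N m vs u) vs) vs) (byDegree N (List.range n))))

/-- Search for `m`-colour-critical graphs with minimum degree at least `d` and no universal vertex,
in which the pairs of `N` are adjacent and the pairs of `K` are not. A colouring of `N` is not one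
of the graph, hence one of its open pairs is an edge of the graph. The result is `true` if all such
graphs contain one of the graphs `Fs`. -/
def search (Fs : List Table) (m d n fuel : ℕ) : Table → Table → Bool :=
  Nat.rec (fun _ _ ↦ false) (fun _ ih N K ↦
    sel (any (fun v ↦ sel (Nat.blt n (Nat.add (size (row K v)) d)) true
        (Nat.ble n (Nat.add (size (row N v)) 1))) (List.range n)) true
      (List.rec (leaf Fs m d n N) (fun _ cs _ ↦
        sel (isCover m (List.range n) cs)
          (fold (fun p r K ↦ sel (ih (Nat.lor N (edge p.1 p.2)) K) (r (Nat.lor K (edge p.1 p.2)))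
            false) (fun _ ↦ true) (branches N K cs (List.range n)) K) false)
        (bestColoring N K (byDegree N (List.range n)) m 0 [] []))) fuel

section Basic

variable {α : Type} {p : α → Bool} {a b : α} {l : List α} {key : α → ℕ} {u v i j x y m : ℕ}
  {N K : Table} {vs cs : List ℕ}

@[simp] theorem sel_true (x y : α) : sel true x y = x := rfl

@[simp] theorem sel_false (x y : α) : sel false x y = y := rfl

@[simp] theorem fold_nil {β : Type} (f : α → β → β) (b : β) : fold f b [] = b := rfl

@[simp] theorem fold_cons {β : Type} (f : α → β → β) (b : β) (a : α) (l : List α) :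
    fold f b (a :: l) = f a (fold f b l) := rfl

theorem sel_eq_ite (b : Bool) (x y : α) : sel b x y = if b then x else y := by
  cases b <;> rfl

theorem sel_and_iff {b c : Bool} : sel b c false ↔ b ∧ c := by cases b <;> simp

theorem sel_not_and_iff {b c : Bool} : sel b false c ↔ b = false ∧ c := by cases b <;> simp

theorem sel_or_iff {b c : Bool} : sel b true c ↔ b ∨ c := by cases b <;> simp

theorem sel_imp_iff {b c : Bool} : sel b c true ↔ (b → c) := by cases b <;> simp

@[simp] theorem any_eq_true_iff : any p l ↔ ∃ a ∈ l, p a := by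
  induction l with
  | nil => simp [any]
  | cons a l ih => cases h : p a <;> simp_all [any]

@[simp] theorem all_eq_true_iff : all p l ↔ ∀ a ∈ l, p a := by
  induction l with
  | nil => simp [all]
  | cons a l ih => cases h : p a <;> simp_all [all]

theorem mem_insertBy : a ∈ insertBy key b l ↔ a = b ∨ a ∈ l := by
  induction l with
  | nil => exact List.mem_singleton.trans (by simp)
  | cons c l ih =>
    change a ∈ sel (Nat.ble (key b) (key c)) (b :: c :: l) (c :: insertBy key b l) ↔ _
    cases Nat.ble (key b) (key c) <;> simp [ih, or_left_comm]

theorem mem_sortBy : a ∈ sortBy key l ↔ a ∈ l := by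
  induction l with
  | nil => rfl
  | cons b l ih => exact (mem_insertBy (l := sortBy key l)).trans (by rw [ih, List.mem_cons])

theorem testBit_row : (row N u).testBit v ↔ v < 10 ∧ N.testBit (10 * u + v) := by
  change ((N >>> (10 * u)) &&& (2 ^ 10 - 1)).testBit v ↔ _
  rw [Nat.testBit_and, Nat.testBit_shiftRight, Nat.testBit_two_pow_sub_one, Bool.and_eq_true,
    decide_eq_true_eq, and_comm]

theorem row_lt : row N u < 1024 := Nat.and_lt_two_pow (n := 10) _ (by norm_num)

theorem testBit_row_lor :
    (row (Nat.lor N K) u).testBit v ↔ (row N u).testBit v ∨ (row K u).testBit v := by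
  change (row (N ||| K) u).testBit v ↔ _
  simp only [testBit_row, Nat.testBit_lor, Bool.or_eq_true, and_or_left]

theorem testBit_row_edge (hi : i < 10) (hj : j < 10) :
    (row (edge i j) u).testBit v ↔ u = i ∧ v = j ∨ u = j ∧ v = i := by
  change (row (2 ^ (10 * i + j) ||| 2 ^ (10 * j + i)) u).testBit v ↔ _
  simp only [testBit_row, Nat.testBit_lor, Nat.testBit_two_pow, Bool.or_eq_true,
    decide_eq_true_eq]
  lia

theorem disjoint_eq_true_iff : disjoint x y ↔ ∀ i, x.testBit i → ¬ y.testBit i := by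
  change Nat.beq (x &&& y) 0 ↔ _
  rw [Nat.beq_eq]
  constructor
  · intro h i hx hy
    simpa [hx, hy] using congrArg (Nat.testBit · i) h
  · intro h
    refine Nat.eq_of_testBit_eq fun i ↦ ?_
    cases hx : x.testBit i
    · simp [hx]
    · simp [Bool.eq_false_iff.2 (h i hx)]

theorem disjoint_two_pow_eq_false_iff : disjoint (Nat.pow 2 u) x = false ↔ x.testBit u := by
  have h : disjoint (2 ^ u) x ↔ ¬ x.testBit u := by
    simp [disjoint_eq_true_iff, Nat.testBit_two_pow]
  exact Bool.eq_false_iff.trans (h.not.trans not_not)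

theorem size_eq (hx : x < 1024) : size x = ((Finset.range 10).filter (x.testBit ·)).card := by
  have h : ∀ x < 1024, size x = ((Finset.range 10).filter (x.testBit ·)).card := by
    decide +kernel
  exact h x hx

theorem classOf_mem_and_testBit (h : disjoint (Nat.pow 2 v) (classOf v cs) = false) :
    classOf v cs ∈ cs ∧ (classOf v cs).testBit v := by
  refine ⟨?_, disjoint_two_pow_eq_false_iff.1 h⟩
  induction cs with
  | nil => simp [classOf, disjoint] at h
  | cons c cs ih =>
    change disjoint _ (sel (disjoint (Nat.pow 2 v) c) (classOf v cs) c) = false at h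
    change sel (disjoint (Nat.pow 2 v) c) (classOf v cs) c ∈ _
    cases hc : disjoint (Nat.pow 2 v) c
    · exact List.mem_cons_self
    · rw [hc] at h
      exact List.mem_cons_of_mem _ (ih h)

theorem isCover_eq_true_iff : isCover m vs cs ↔
    cs.length ≤ m ∧ ∀ v ∈ vs, disjoint (Nat.pow 2 v) (classOf v cs) = false := by
  simp only [isCover, sel_and_iff, sel_not_and_iff, all_eq_true_iff, Nat.ble_eq, and_true]

theorem mem_fold_iff {β : Type} {f : α → List β → List β} {q : α → Prop} {r : List β}
    {b : β} (hf : ∀ a r, b ∈ f a r ↔ b ∈ r ∨ q a) : b ∈ fold f r l ↔ b ∈ r ∨ ∃ a ∈ l, q a := by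
  induction l with
  | nil => simp
  | cons a l ih => simp [hf, ih, or_comm, or_left_comm]

theorem mem_sel_cons_iff {c : Bool} : b ∈ sel c l (a :: l) ↔ b ∈ l ∨ b = a ∧ c = false := by
  cases c <;> simp [or_comm]

theorem mem_openPairs_iff {p : ℕ × ℕ} : p ∈ openPairs K cs vs ↔
    ∃ v ∈ vs, ∃ u ∈ vs, p = (u, v) ∧ u < v ∧ u < 10 ∧ (classOf v cs).testBit u ∧
      ¬ (row K v).testBit u := by
  have hopen (u v : ℕ) : disjoint (Nat.pow 2 u) (openSet K cs v) = false ↔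
      u < v ∧ u < 10 ∧ (classOf v cs).testBit u ∧ ¬ (row K v).testBit u := by
    rw [disjoint_two_pow_eq_false_iff]
    change ((classOf v cs &&& ((2 ^ 10 - 1) ^^^ row K v)) &&& (2 ^ v - 1)).testBit u ↔ _
    rw [Nat.testBit_and, Nat.testBit_and, Nat.testBit_xor, Nat.testBit_two_pow_sub_one,
      Nat.testBit_two_pow_sub_one]
    have hlt (h : (row K v).testBit u) : u < 10 := (testBit_row.1 h).1
    grind
  have hfold (v : ℕ) (r : List (ℕ × ℕ)) := mem_fold_iff (l := vs) (r := r) (b := p)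
    (f := fun u r ↦ sel (disjoint (Nat.pow 2 u) (openSet K cs v)) r ((u, v) :: r))
    fun u r ↦ mem_sel_cons_iff
  simpa only [openPairs, hopen, List.not_mem_nil, false_or] using mem_fold_iff (l := vs) (r := [])
    (f := fun v r ↦ fold _ r vs) hfold

end Basic

section Coloring

variable {N K : Table} {vs cs ks best : List ℕ} {col : ℕ → ℕ} {r u v k m cost : ℕ}
  {next : ℕ → List ℕ → List ℕ → List ℕ}

theorem ne_nil_of_better_eq_false (h : better cost best = false) : best ≠ [] := by
  rintro rfl
  cases h

theorem placeInClass_cons {c : ℕ} :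
    placeInClass r v u (c :: cs) cost next best =
      placeInClass r v u cs cost (fun cost t ↦ next cost (c :: t)) (sel (disjoint r c)
        (sel (better (cost + size (Nat.land c u)) best)
          (next (cost + size (Nat.land c u)) (Nat.lor c v :: cs) best) best) best) :=
  rfl

theorem placeInClass_ne_nil_of_ne_nil (hnext : ∀ cost cs best, best ≠ [] → next cost cs best ≠ [])
    (hbest : best ≠ []) : placeInClass r v u cs cost next best ≠ [] := by
  induction cs generalizing next best with
  | nil => exact hbest
  | cons c cs ih =>
    rw [placeInClass_cons]
    refine ih (fun cost _ ↦ hnext cost _) ?_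
    simp only [sel_eq_ite]
    split_ifs
    exacts [hnext _ _ _ hbest, hbest, hbest]

/-- The classes `cs` have the colours `ks`. -/
def HasColors (col : ℕ → ℕ) : List ℕ → List ℕ → Prop :=
  List.Forall₂ fun c k ↦ ∀ x, c.testBit x → col x = k

theorem placeInClass_ne_nil (hr : ∀ x, r.testBit x → col v ≠ col x) (hcs : HasColors col cs ks)
    (hv : col v ∈ ks) (hnext : ∀ cost cs best, best ≠ [] → next cost cs best ≠ [])
    (hcol : ∀ cost cs best, HasColors col cs ks → next cost cs best ≠ []) :
    placeInClass r (Nat.pow 2 v) u cs cost next best ≠ [] := by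
  induction hcs generalizing next best with
  | nil => cases hv
  | @cons c k cs ks hc hcs ih =>
    rw [placeInClass_cons]
    rcases List.mem_cons.1 hv with rfl | hv
    · refine placeInClass_ne_nil_of_ne_nil (fun cost _ ↦ hnext cost _) ?_
      have hdisjoint : disjoint r c := disjoint_eq_true_iff.2 fun x hx hxc ↦ hr x hx (hc x hxc).symm
      rw [hdisjoint, sel_true, sel_eq_ite]
      split_ifs with h
      · refine hcol _ _ _ (.cons (fun x hx ↦ ?_) hcs)
        change (c ||| 2 ^ v).testBit x at hx
        rw [Nat.testBit_lor, Nat.testBit_two_pow, Bool.or_eq_true, decide_eq_true_eq] at hx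
        exact hx.elim (hc x) fun h ↦ h ▸ rfl
      · exact ne_nil_of_better_eq_false (Bool.eq_false_iff.2 h)
    · exact ih hv (fun cost _ ↦ hnext cost _) fun cost cs' best h ↦ hcol _ _ _ (.cons hc h)

theorem bestColoring_ne_nil_of_ne_nil (hbest : best ≠ []) :
    bestColoring N K vs k cost cs best ≠ [] := by
  induction vs generalizing k cost cs best with
  | nil => exact List.cons_ne_nil _ _
  | cons v vs ih =>
    refine placeInClass_ne_nil_of_ne_nil (fun _ _ _ ↦ ih) ?_
    cases k with
    | zero => exact hbest
    | succ k =>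
      change sel (better cost best) (bestColoring N K vs k cost _ best) best ≠ []
      rw [sel_eq_ite]
      split_ifs
      exacts [ih hbest, hbest]

theorem bestColoring_ne_nil (hadj : ∀ u ∈ vs, ∀ v, (row N u).testBit v → col u ≠ col v)
    (hm : ∀ v ∈ vs, col v < m) (hcs : HasColors col cs ks) (hks : ks.Nodup)
    (hksm : ∀ i ∈ ks, i < m) (hk : ks.length + k = m) :
    bestColoring N K vs k cost cs best ≠ [] := by
  induction vs generalizing k cost cs ks best with
  | nil => exact List.cons_ne_nil _ _
  | cons v vs ih =>
    rw [List.forall_mem_cons] at hadj hm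
    by_cases hv : col v ∈ ks
    · exact placeInClass_ne_nil hadj.1 hcs hv (fun _ _ _ ↦ bestColoring_ne_nil_of_ne_nil)
        fun _ _ _ h ↦ ih hadj.2 hm.2 h hks hksm hk
    refine placeInClass_ne_nil_of_ne_nil (fun _ _ _ ↦ bestColoring_ne_nil_of_ne_nil) ?_
    have hksv : (col v :: ks).Nodup := List.nodup_cons.2 ⟨hv, hks⟩
    have hlt : ∀ i ∈ col v :: ks, i < m := List.forall_mem_cons.2 ⟨hm.1, hksm⟩
    have hsubset : (col v :: ks).toFinset ⊆ Finset.range m :=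
      fun i hi ↦ Finset.mem_range.2 (hlt i (List.mem_toFinset.1 hi))
    have hlength : ks.length + 1 ≤ m := by
      simpa only [List.toFinset_card_of_nodup hksv, List.length_cons, Finset.card_range] using
        Finset.card_le_card hsubset
    obtain _ | k := k
    · lia
    change sel (better cost best) (bestColoring N K vs k cost _ best) best ≠ []
    rw [sel_eq_ite]
    split_ifs with h
    · refine ih hadj.2 hm.2 (.cons (fun x hx ↦ ?_) hcs) hksv hlt (by simp; lia)
      rw [show Nat.pow 2 v = 2 ^ v from rfl, Nat.testBit_two_pow, decide_eq_true_eq] at hx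
      exact congrArg col hx.symm
    · exact ne_nil_of_better_eq_false (Bool.eq_false_iff.2 h)

end Coloring

/-- The table `N` is symmetric, and all its entries satisfy the relation `R` on `{0, …, n - 1}`. -/
def Entries {n : ℕ} (N : Table) (R : Fin n → Fin n → Prop) : Prop :=
  ∀ u v, (row N u).testBit v → (row N v).testBit u ∧ ∃ a b : Fin n, a = u ∧ b = v ∧ R a b

/-- The graph with the given table. -/
def graph (n : ℕ) (N : Table) : SimpleGraph (Fin n) where
  Adj a b := a ≠ b ∧ (row N a).testBit b ∧ (row N b).testBit a
  symm := ⟨fun _ _ h ↦ ⟨h.1.symm, h.2.2, h.2.1⟩⟩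
  loopless := ⟨fun _ h ↦ h.1 rfl⟩

section Soundness

open scoped Classical

variable {n m d : ℕ} {N K F : Table} {Fs : List Table} {R S : Fin n → Fin n → Prop} {a b : Fin n}
  {G : SimpleGraph (Fin n)} {vs cs is : List ℕ}

theorem Entries.of_testBit (h : Entries N R) (hab : (row N a).testBit b) : R a b := by
  obtain ⟨-, a', b', ha, hb, hR⟩ := h a b hab
  rwa [Fin.ext ha, Fin.ext hb] at hR

theorem Entries.mono (h : Entries N R) (hRS : ∀ a b : Fin n, (row N a).testBit b → R a b → S a b) :
    Entries N S := by
  intro u v huv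
  obtain ⟨hvu, a, b, rfl, rfl, hab⟩ := h u v huv
  exact ⟨hvu, a, b, rfl, rfl, hRS a b huv hab⟩

theorem Entries.lor_edge (h : Entries N R) (hn : n ≤ 10) (hab : R a b) (hba : R b a) :
    Entries (Nat.lor N (edge a b)) R := by
  intro u v huv
  rw [testBit_row_lor, testBit_row_edge (by lia) (by lia)] at huv ⊢
  rcases huv with huv | ⟨rfl, rfl⟩ | ⟨rfl, rfl⟩
  · exact ⟨.inl (h u v huv).1, (h u v huv).2⟩
  · exact ⟨.inr (.inr ⟨rfl, rfl⟩), a, b, rfl, rfl, hab⟩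
  · exact ⟨.inr (.inl ⟨rfl, rfl⟩), b, a, rfl, rfl, hba⟩

theorem entries_zero : Entries 0 R := fun u v h ↦ by simp [testBit_row] at h

theorem Entries.graph_adj_iff (h : Entries N G.Adj) :
    (graph n N).Adj a b ↔ (row N a).testBit b :=
  ⟨fun hab ↦ hab.2.1, fun hab ↦ ⟨(h.of_testBit hab).ne, hab, (h a b hab).1⟩⟩

theorem Entries.graph_le (h : Entries N G.Adj) : graph n N ≤ G :=
  fun _ _ hab ↦ h.of_testBit hab.2.1

theorem Entries.entries_graph (h : Entries N G.Adj) : Entries N (graph n N).Adj :=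
  h.mono fun _ _ hab _ ↦ h.graph_adj_iff.2 hab

theorem Entries.size_row_le (h : Entries N R) (a : Fin n) [DecidablePred (R a)] :
    size (row N a) ≤ (Finset.univ.filter (R a)).card := by
  rw [size_eq row_lt, ← Finset.card_map Fin.valEmbedding]
  refine Finset.card_le_card fun v hv ↦ ?_
  obtain ⟨-, a', b, ha, rfl, hR⟩ := h a v (Finset.mem_filter.1 hv).2
  rw [Fin.ext ha] at hR
  exact Finset.mem_map_of_mem Fin.valEmbedding (by simpa using hR)

theorem card_filter_le_size_row [DecidablePred (R a)] (h : ∀ b, R a b → (row N a).testBit b) :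
    (Finset.univ.filter (R a)).card ≤ size (row N a) := by
  rw [size_eq row_lt, ← Finset.card_map Fin.valEmbedding]
  refine Finset.card_le_card fun v hv ↦ ?_
  obtain ⟨b, hb, rfl⟩ := Finset.mem_map.1 hv
  have hb := h b (Finset.mem_filter.1 hb).2
  exact Finset.mem_filter.2 ⟨Finset.mem_range.2 (testBit_row.1 hb).1, hb⟩

theorem Entries.size_row_le_degree (h : Entries N G.Adj) (a : Fin n) :
    size (row N a) ≤ G.degree a := by
  rw [← SimpleGraph.card_neighborFinset_eq_degree, SimpleGraph.neighborFinset_eq_filter]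
  exact h.size_row_le a

theorem Entries.size_row_add_degree_le (h : Entries K fun a b ↦ ¬ G.Adj a b) (a : Fin n) :
    size (row K a) + G.degree a ≤ n := by
  have hsplit := Finset.card_filter_add_card_filter_not (s := Finset.univ) (G.Adj a)
  rw [← SimpleGraph.neighborFinset_eq_filter, SimpleGraph.card_neighborFinset_eq_degree,
    Finset.card_fin] at hsplit
  have := h.size_row_le a
  lia

theorem Entries.bestColoring_ne_nil (hN : Entries N G.Adj) (hG : G.Colorable m)
    (hvs : ∀ v ∈ vs, v < n) : bestColoring N K vs m 0 [] [] ≠ [] := by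
  obtain ⟨c⟩ := hG
  let col (u : ℕ) : ℕ := if h : u < n then c ⟨u, h⟩ else 0
  have hcol (a : Fin n) : col a = c a := dif_pos a.2
  refine Table.bestColoring_ne_nil (col := col) (m := m) (fun u _ v huv ↦ ?_) (fun v hv ↦ ?_) .nil
    List.nodup_nil (by simp) (by simp)
  · obtain ⟨-, a, b, rfl, rfl, hab⟩ := hN u v huv
    rw [hcol, hcol, Fin.val_ne_iff]
    exact c.valid hab
  · exact (hcol ⟨v, hvs v hv⟩).trans_lt (c _).2

theorem Entries.not_colorable (hN : Entries N G.Adj) (hvs : ∀ v ∈ vs, v < n)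
    (h : colorable N m vs = false) : ¬ G.Colorable m := by
  intro hG
  unfold colorable at h
  cases hc : bestColoring N (2 ^ 100 - 1) vs m 0 [] []
  · exact hN.bestColoring_ne_nil hG hvs hc
  · rw [hc] at h
    cases h

theorem colorable_of_openPairs (hn : n ≤ 10) (hcover : isCover m (List.range n) cs)
    (hK : Entries K fun a b ↦ ¬ G.Adj a b)
    (h : ∀ a b : Fin n, (a.1, b.1) ∈ openPairs K cs (List.range n) → ¬ G.Adj a b) :
    G.Colorable m := by
  obtain ⟨hm, hcover⟩ := isCover_eq_true_iff.1 hcover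
  have hclass (b : Fin n) := classOf_mem_and_testBit (hcover b (List.mem_range.2 b.2))
  have hlt (a b : Fin n) (hab : a < b) (hadj : G.Adj a b) : classOf a cs ≠ classOf b cs := by
    intro heq
    refine h a b (mem_openPairs_iff.2 ⟨b, List.mem_range.2 b.2, a, List.mem_range.2 a.2, rfl, hab,
      by lia, heq ▸ (hclass a).2, fun hKab ↦ hK.of_testBit hKab hadj.symm⟩) hadj
  refine (colorableOn_univ.1 (colorableOn_card_palette (fun b : Fin n ↦ classOf b cs) cs.toFinset
    (fun b _ ↦ List.mem_toFinset.2 (hclass b).1) fun a _ b _ hab ↦ ?_)).mono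
    ((List.toFinset_card_le _).trans hm)
  rcases lt_or_gt_of_ne hab.ne with h | h
  exacts [hlt a b h hab, (hlt b a h hab.symm).symm]

theorem exists_of_extendsToHom {used : ℕ} {f : List (ℕ × ℕ)} (his : is.Pairwise (· < ·))
    (h : extendsToHom F N n is used f) :
    ∃ g : ℕ → ℕ, ∀ i ∈ is, g i < n ∧
      (∀ p ∈ f, (row F i).testBit p.1 → (row N (g i)).testBit p.2) ∧
      ∀ j ∈ is, j < i → (row F i).testBit j → (row N (g i)).testBit (g j) := by
  induction is generalizing used f with
  | nil => exact ⟨id, by simp⟩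
  | cons i is ih =>
    rw [List.pairwise_cons] at his
    change any _ _ at h
    simp only [any_eq_true_iff, sel_and_iff, all_eq_true_iff, sel_imp_iff, List.mem_range] at h
    obtain ⟨v, hv, -, -, hf, h⟩ := h
    obtain ⟨g, hg⟩ := ih his.2 h
    have hne : ∀ j ∈ is, j ≠ i := fun j hj ↦ (his.1 j hj).ne'
    refine ⟨Function.update g i v, List.forall_mem_cons.2 ⟨?_, fun j hj ↦ ?_⟩⟩
    · simp only [Function.update_self, List.forall_mem_cons, lt_irrefl, false_imp_iff, true_and]
      exact ⟨hv, hf, fun j hj hji ↦ absurd (his.1 j hj) hji.not_gt⟩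
    · obtain ⟨hgj, hfj, hisj⟩ := hg j hj
      rw [List.forall_mem_cons] at hfj
      simp only [Function.update_of_ne (hne j hj), List.forall_mem_cons, Function.update_self]
      refine ⟨hgj, hfj.2, fun _ ↦ hfj.1, fun k hk hkj ↦ ?_⟩
      rw [Function.update_of_ne (hne k hk)]
      exact hisj k hk hkj

theorem Entries.nonempty_hom (hN : Entries N G.Adj)
    (h : extendsToHom F N n (List.range n) 0 []) : Nonempty (graph n F →g G) := by
  obtain ⟨g, hg⟩ := exists_of_extendsToHom List.pairwise_lt_range h
  have hg (a : Fin n) := hg a (List.mem_range.2 a.2)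
  let f (a : Fin n) : Fin n := ⟨g a, (hg a).1⟩
  have hf (a b : Fin n) (hba : b < a) (hab : (graph n F).Adj a b) : G.Adj (f a) (f b) :=
    hN.of_testBit ((hg a).2.2 b (List.mem_range.2 b.2) hba hab.2.1)
  refine ⟨f, fun {a b} hab ↦ ?_⟩
  rcases lt_or_gt_of_ne hab.ne with h | h
  exacts [(hf b a h hab.symm).symm, hf a b h hab]

theorem Entries.not_isRedundant (hn : n ≤ 10) (hN : Entries N G.Adj)
    (hG : MinNonColorable G m) (hvs : ∀ v ∈ vs, v < n) {u v : ℕ} : ¬ isRedundant N m vs u v := by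
  intro h
  simp only [isRedundant, sel_not_and_iff, disjoint_two_pow_eq_false_iff, and_true] at h
  obtain ⟨-, b, a, rfl, rfl, hab⟩ := hN v u h.1
  refine Entries.not_colorable (G := G.deleteEdges {s(a, b)}) (fun u v huv ↦ ?_) hvs h.2
    (hG.erase_edge a b hab.symm)
  have hrow (u v : ℕ) : (row (Nat.xor N (Nat.land N (edge a b))) u).testBit v ↔
      (row N u).testBit v ∧ ¬ (row (edge a b) u).testBit v := by
    change (row (N ^^^ (N &&& edge a b)) u).testBit v ↔ _
    simp only [testBit_row, Nat.testBit_xor, Nat.testBit_and]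
    grind
  rw [hrow, testBit_row_edge (by lia) (by lia)] at huv ⊢
  obtain ⟨hvu, c, d, rfl, rfl, hcd⟩ := hN u v huv.1
  refine ⟨⟨hvu, by grind⟩, c, d, rfl, rfl, ?_⟩
  rw [SimpleGraph.deleteEdges_adj]
  exact ⟨hcd, by simp only [Set.mem_singleton_iff, Sym2.eq_iff, Fin.ext_iff]; grind⟩

theorem Entries.exists_hom_of_leaf (hn : n ≤ 10) (hN : Entries N G.Adj) (hG : MinNonColorable G m)
    (hd : ∀ v, d ≤ G.degree v) (hgraph : ¬ (graph n N).Colorable m) (h : leaf Fs m d n N) :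
    ∃ F ∈ Fs, Nonempty (graph n F →g G) := by
  have hrow (a b : Fin n) (hab : G.Adj a b) : (row N a).testBit b :=
    hN.graph_adj_iff.1 (hG.adj_of_hom hgraph (.ofLE hN.graph_le) Function.injective_id hab)
  simp only [leaf, sel_or_iff, sel_and_iff, any_eq_true_iff, Nat.blt_eq, List.mem_range] at h
  rcases h with ⟨v, hv, hlt⟩ | ⟨F, hF, -, h⟩ | ⟨u, -, v, -, h⟩
  · refine absurd ((hd ⟨v, hv⟩).trans ?_) hlt.not_ge
    rw [← SimpleGraph.card_neighborFinset_eq_degree, SimpleGraph.neighborFinset_eq_filter]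
    exact card_filter_le_size_row (hrow ⟨v, hv⟩)
  · exact ⟨F, hF, hN.nonempty_hom h⟩
  · refine absurd h (hN.not_isRedundant hn hG fun v hv ↦ ?_)
    exact List.mem_range.1 (mem_sortBy.1 hv)

theorem Entries.exists_hom_of_branch {next : Table → Table → Bool} {l : List (ℕ × ℕ)} (hn : n ≤ 10)
    (hnext : ∀ N K, Entries N G.Adj → Entries K (fun a b ↦ ¬ G.Adj a b) → next N K →
      ∃ F ∈ Fs, Nonempty (graph n F →g G))
    (hN : Entries N G.Adj) (hK : Entries K fun a b ↦ ¬ G.Adj a b)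
    (hl : ∀ p ∈ l, ∃ a b : Fin n, p = (a.1, b.1))
    (h : fold (fun p r K ↦ sel (next (Nat.lor N (edge p.1 p.2)) K) (r (Nat.lor K (edge p.1 p.2)))
      false) (fun _ ↦ true) l K) :
    (∃ F ∈ Fs, Nonempty (graph n F →g G)) ∨ ∀ a b : Fin n, (a.1, b.1) ∈ l → ¬ G.Adj a b := by
  induction l generalizing K with
  | nil => simp
  | cons p l ih =>
    rw [List.forall_mem_cons] at hl
    obtain ⟨⟨a, b, rfl⟩, hl⟩ := hl
    rw [fold_cons, sel_and_iff] at h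
    by_cases hab : G.Adj a b
    · exact .inl (hnext _ _ (hN.lor_edge hn hab hab.symm) hK h.1)
    · refine (ih (hK.lor_edge hn hab fun hba ↦ hab hba.symm) hl h.2).imp_right fun hl c d hcd ↦ ?_
      rcases List.mem_cons.1 hcd with hcd | hcd
      · simp only [Prod.mk.injEq, ← Fin.ext_iff] at hcd
        rwa [hcd.1, hcd.2]
      · exact hl c d hcd

theorem exists_hom_of_search {fuel : ℕ} (hn : n ≤ 10) (hG : MinNonColorable G m)
    (hd : ∀ v, d ≤ G.degree v) (hG' : ∀ v, ¬ G.IsUniversal v) (hN : Entries N G.Adj)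
    (hK : Entries K fun a b ↦ ¬ G.Adj a b) (h : search Fs m d n fuel N K) :
    ∃ F ∈ Fs, Nonempty (graph n F →g G) := by
  induction fuel generalizing N K with
  | zero => cases h
  | succ fuel ih =>
    change sel _ true _ at h
    simp only [sel_or_iff, any_eq_true_iff, Nat.blt_eq, Nat.ble_eq, List.mem_range] at h
    rcases h with ⟨v, hv, hdeg⟩ | h
    · have hle := hN.size_row_le_degree ⟨v, hv⟩
      have hlt := (G.degree_lt_card_sub_one ⟨v, hv⟩).2 (hG' ⟨v, hv⟩)
      have hK := hK.size_row_add_degree_le ⟨v, hv⟩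
      have hd := hd ⟨v, hv⟩
      rw [Fintype.card_fin] at hlt
      lia
    cases hc : bestColoring N K (byDegree N (List.range n)) m 0 [] [] with
    | nil =>
      rw [hc] at h
      refine hN.exists_hom_of_leaf hn hG hd (fun hgraph ↦ ?_) h
      exact hN.entries_graph.bestColoring_ne_nil hgraph
        (fun v hv ↦ List.mem_range.1 (mem_sortBy.1 hv)) hc
    | cons cost cs =>
      rw [hc] at h
      obtain ⟨hcover, h⟩ := sel_and_iff.1 h
      have hpairs : ∀ p ∈ branches N K cs (List.range n), ∃ a b : Fin n, p = (a.1, b.1) := by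
        intro p hp
        obtain ⟨b, hb, a, ha, rfl, -⟩ := mem_openPairs_iff.1 (mem_sortBy.1 hp)
        exact ⟨⟨a, List.mem_range.1 ha⟩, ⟨b, List.mem_range.1 hb⟩, rfl⟩
      refine (hN.exists_hom_of_branch hn (fun N K ↦ ih) hK hpairs h).resolve_right fun h ↦ ?_
      exact hG.not_colorable (colorable_of_openPairs hn hcover hK fun a b hab ↦
        h a b (mem_sortBy.2 hab))

end Soundness
section Labelling

variable {n m d : ℕ} {R : ℕ → ℕ → Bool} {S : Fin n → Fin n → Prop}

theorem entries_ofRel (hn : n ≤ 10) (h : ∀ a b : Fin n, R a b → S a b ∧ S b a) :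
    Entries (ofRel R n) S := by
  have hrow (a : Fin n) (l : List ℕ) (hl : ∀ v ∈ l, v < n) {N : Table} (hN : Entries N S) :
      Entries (fold (fun v N ↦ sel (R a v) (Nat.lor N (edge a v)) N) N l) S := by
    induction l with
    | nil => exact hN
    | cons v l ih =>
      rw [List.forall_mem_cons] at hl
      rw [fold_cons, sel_eq_ite]
      split_ifs with hav
      · exact (ih hl.2).lor_edge (b := ⟨v, hl.1⟩) hn (h a ⟨v, hl.1⟩ hav).1 (h a ⟨v, hl.1⟩ hav).2
      · exact ih hl.2
  have hrows (l : List ℕ) (hl : ∀ u ∈ l, u < n) :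
      Entries (fold (fun u N ↦ fold (fun v N ↦ sel (R u v) (Nat.lor N (edge u v)) N) N
        (List.range n)) 0 l) S := by
    induction l with
    | nil => exact entries_zero
    | cons u l ih =>
      rw [List.forall_mem_cons] at hl
      exact hrow ⟨u, hl.1⟩ _ (fun v hv ↦ List.mem_range.1 hv) (ih hl.2)
  exact hrows _ fun u hu ↦ List.mem_range.1 hu

/-- The labels of `m` classes, of which the `i`-th one contains `α i` marked and `β i` unmarked
vertices, followed by the label `none` of the hub. A vertex of class `i` has the label `(i, b)`,
where `b` tells whether it is marked. -/
def labels (α β : Fin m → ℕ) : List (Option (Fin m × Bool)) :=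
  ((List.finRange m).flatMap fun i ↦
    List.replicate (α i) (some (i, true)) ++ List.replicate (β i) (some (i, false))) ++ [none]

/-- Whether vertices with the given labels are adjacent since a marked vertex is a neighbour of the
hub. -/
def joined : Option (Fin m × Bool) → Option (Fin m × Bool) → Bool
  | none, some (_, b) => b
  | _, _ => false

/-- Whether vertices with the given labels are not adjacent, since the classes are independent and,
if `full` is true, all neighbours of the hub are marked. -/
def separated (full : Bool) : Option (Fin m × Bool) → Option (Fin m × Bool) → Bool
  | none, none => true
  | none, some (_, b) => full && !b
  | some (i, _), some (j, _) => i == j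
  | some _, none => false

/-- The search for graphs with a hub, the rest of which is divided into `m` independent classes as
described by `labels α β`. -/
def hubSearch (Fs : List Table) (d n : ℕ) (full : Bool) (α β : Fin m → ℕ) : Bool :=
  search Fs m d n 40
    (ofRel (fun u v ↦ joined ((labels α β).getD u none) ((labels α β).getD v none)) n)
    (ofRel (fun u v ↦ separated full ((labels α β).getD u none) ((labels α β).getD v none)) n)

theorem count_labels_none {α β : Fin m → ℕ} :
    (labels α β : Multiset (Option (Fin m × Bool))).count none = 1 := by
  simp only [Multiset.coe_count, labels, List.count_append, List.count_flatMap, Function.comp_def,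
    List.count_replicate, beq_iff_eq, reduceCtorEq, if_false, add_zero, List.map_const',
    List.sum_replicate, nsmul_zero, List.count_singleton_self]

theorem count_labels_some {α β : Fin m → ℕ} {i : Fin m} {b : Bool} :
    (labels α β : Multiset (Option (Fin m × Bool))).count (some (i, b)) =
      bif b then α i else β i := by
  cases b <;>
    simp [labels, List.count_flatMap, List.count_replicate, Function.comp_def, ← List.ofFn_eq_map,
      List.sum_ofFn]

theorem exists_equiv_of_map_val {V κ : Type*} [Fintype V] {t : V → κ} {T : List κ}
    (hT : Finset.univ.val.map t = T) (hn : Fintype.card V = n) (k₀ : κ) :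
    ∃ e : Fin n ≃ V, ∀ i, t (e i) = T.getD i k₀ := by
  classical
  obtain rfl : T.length = n := by
    rw [← hn, ← Multiset.coe_card, ← hT, Multiset.card_map, Finset.card_val, Finset.card_univ]
  have hcard (k : κ) : Fintype.card {i // T.get i = k} = Fintype.card {x // t x = k} := by
    have hk := congrArg (Multiset.count k) (Fin.univ_val_map T.get)
    rw [List.ofFn_get, ← hT, Multiset.count_map, Multiset.count_map] at hk
    rw [Fintype.card_subtype, Fintype.card_subtype, Finset.card_def, Finset.card_def,
      Finset.filter_val, Finset.filter_val]
    simpa only [eq_comm (a := k)] using hk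
  refine ⟨Equiv.ofFiberEquiv fun k ↦ Fintype.equivOfCardEq (hcard k), fun i ↦ ?_⟩
  rw [List.getD_eq_getElem _ _ i.2]
  exact Equiv.ofFiberEquiv_map (f := T.get) (g := t) _ i

theorem exists_hom_of_hubSearch {V : Type*} [Fintype V] {G : SimpleGraph V} {Fs : List Table}
    {full : Bool} {α β : Fin m → ℕ} [DecidableRel G.Adj] (hcard : Fintype.card V = n) (hn : n ≤ 10)
    (hG : MinNonColorable G m) (hd : ∀ v, d ≤ G.degree v) (hG' : ∀ v, ¬ G.IsUniversal v)
    (t : V → Option (Fin m × Bool)) (ht : Finset.univ.val.map t = labels α β)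
    (hjoined : ∀ x y, joined (t x) (t y) → G.Adj x y)
    (hseparated : ∀ x y, separated full (t x) (t y) → ¬ G.Adj x y)
    (h : hubSearch Fs d n full α β) : ∃ F ∈ Fs, Nonempty (graph n F →g G) := by
  classical
  obtain ⟨e, he⟩ := exists_equiv_of_map_val ht hcard none
  let φ : G.comap e ≃g G := .comap e G
  have hd (i : Fin n) : d ≤ (G.comap e).degree i := (hd (φ i)).trans_eq (φ.degree_eq i)
  have hG' (i : Fin n) : ¬ (G.comap e).IsUniversal i := fun hi ↦ hG' (φ i) fun x hx ↦ by
    rw [← φ.apply_symm_apply x] at hx ⊢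
    exact φ.map_adj_iff.2 (hi fun h ↦ hx (congrArg φ h))
  have hN := entries_ofRel (S := (G.comap e).Adj)
    (R := fun u v ↦ joined ((labels α β).getD u none) ((labels α β).getD v none)) hn
    fun a b hab ↦ by
      rw [← he, ← he] at hab
      exact ⟨hjoined _ _ hab, (hjoined _ _ hab).symm⟩
  have hK := entries_ofRel (S := fun a b ↦ ¬ (G.comap e).Adj a b)
    (R := fun u v ↦ separated full ((labels α β).getD u none) ((labels α β).getD v none)) hn
    fun a b hab ↦ by
      rw [← he, ← he] at hab
      exact ⟨hseparated _ _ hab, fun hba ↦ hseparated _ _ hab hba.symm⟩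
  obtain ⟨F, hF, ⟨f⟩⟩ := exists_hom_of_search hn (hG.iso φ.symm) (by convert hd) hG' hN hK h
  exact ⟨F, hF, ⟨φ.toHom.comp f⟩⟩

end Labelling
end Table

section Classes

variable {V : Type*} {G : SimpleGraph V} {X : Set V} {m : ℕ} {v : V} {c : V → Fin m}

theorem ColorableOn.exists_fin_coloring [NeZero m] (h : ColorableOn G X m) :
    ∃ c : V → Fin m, ∀ x ∈ X, ∀ y ∈ X, G.Adj x y → c x ≠ c y := by
  obtain ⟨c, hc, hp⟩ := h
  refine ⟨fun x ↦ Fin.ofNat m (c x), fun x hx y hy hxy h ↦ hp x hx y hy hxy ?_⟩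
  simpa [Fin.ext_iff, Nat.mod_eq_of_lt, hc x hx, hc y hy] using h

theorem MinNonColorable.exists_adj_of_coloring (hG : MinNonColorable G m)
    (hc : ∀ x ≠ v, ∀ y ≠ v, G.Adj x y → c x ≠ c y) (i : Fin m) : ∃ x, G.Adj v x ∧ c x = i := by
  classical
  by_contra! h
  refine hG.not_colorable ⟨.mk (Function.update c v i) fun {x y} hxy ↦ ?_⟩
  grind [SimpleGraph.Adj.symm, hxy.ne]

theorem MinNonColorable.le_degree [Fintype (G.neighborSet v)] (hG : MinNonColorable G m)
    (hc : ∀ x ≠ v, ∀ y ≠ v, G.Adj x y → c x ≠ c y) : m ≤ G.degree v := by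
  choose g hvg hcg using hG.exists_adj_of_coloring hc
  rw [← Fintype.card_fin m, ← G.card_neighborSet_eq_degree v]
  exact Fintype.card_le_of_injective (fun i ↦ ⟨g i, hvg i⟩) fun i j hij ↦ by
    have hij : g i = g j := congrArg Subtype.val hij
    rw [← hcg i, ← hcg j, hij]

theorem MinNonColorable.exists_coloring_card_eq_two [Fintype V] [NeZero m] [DecidableEq V]
    (hG : MinNonColorable G m) (hcard : Fintype.card V = 2 * m + 1)
    (hmatch : HasCoMatching G (Finset.univ.erase v)) :
    ∃ c : V → Fin m, (∀ x ≠ v, ∀ y ≠ v, G.Adj x y → c x ≠ c y) ∧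
      ∀ i, ((Finset.univ.erase v).filter (c · = i)).card = 2 := by
  obtain ⟨k, hk, c, hck, hc, hclass⟩ := hmatch.exists_coloring_class_card_eq_two
  obtain rfl : k = m := by
    rw [Finset.card_erase_of_mem (Finset.mem_univ v), Finset.card_univ, hcard] at hk
    lia
  have hval (x : V) (hx : x ≠ v) : (Fin.ofNat k (c x)).1 = c x :=
    Nat.mod_eq_of_lt (hck x (by simpa using hx))
  have hcolor (x : V) (hx : x ≠ v) (y : V) (hy : y ≠ v) (hxy : G.Adj x y) :
      Fin.ofNat k (c x) ≠ Fin.ofNat k (c y) := by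
    rw [ne_eq, Fin.ext_iff, hval x hx, hval y hy]
    exact hc x (by simpa using hx) y (by simpa using hy) hxy
  refine ⟨fun x ↦ Fin.ofNat k (c x), hcolor, fun i ↦ ?_⟩
  obtain ⟨u, hvu, rfl⟩ := hG.exists_adj_of_coloring hcolor i
  rw [← hclass u (by simpa using hvu.ne')]
  refine congrArg Finset.card (Finset.filter_congr fun x hx ↦ ?_)
  rw [Fin.ext_iff, hval x (Finset.ne_of_mem_erase hx), hval u hvu.ne']

end Classes

namespace Table

section Hub

open scoped Classical

variable {V : Type*} [Fintype V] {G : SimpleGraph V} {Fs : List Table} {m n d : ℕ} {v : V}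
  {c : V → Fin m} {M : Finset V} {full : Bool} {α β : Fin m → ℕ}

theorem map_val_eq_labels (hv : v ∉ M) (hα : ∀ i, (M.filter (c · = i)).card = α i)
    (hβ : ∀ i, ((insert v M)ᶜ.filter (c · = i)).card = β i) :
    Finset.univ.val.map (fun x ↦ if x = v then none else some (c x, decide (x ∈ M))) =
      labels α β := by
  refine Multiset.ext.2 fun k ↦ ?_
  rw [Multiset.count_map, ← Finset.filter_val, Finset.card_val]
  obtain _ | ⟨i, _ | _⟩ := k
  · rw [count_labels_none, Finset.card_eq_one]
    exact ⟨v, by grind⟩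
  · rw [count_labels_some, cond_false, ← hβ]
    congr 1
    grind [Finset.mem_compl]
  · rw [count_labels_some, cond_true, ← hα]
    congr 1
    grind

theorem exists_hom_of_hub (hcard : Fintype.card V = n) (hn : n ≤ 10) (hG : MinNonColorable G m)
    (hd : ∀ u, d ≤ G.degree u) (hG' : ∀ u, ¬ G.IsUniversal u)
    (hc : ∀ x ≠ v, ∀ y ≠ v, G.Adj x y → c x ≠ c y) (hM : ∀ x ∈ M, G.Adj v x)
    (hfull : full → ∀ x, G.Adj v x → x ∈ M) (hα : ∀ i, (M.filter (c · = i)).card = α i)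
    (hβ : ∀ i, ((insert v M)ᶜ.filter (c · = i)).card = β i) (h : hubSearch Fs d n full α β) :
    ∃ F ∈ Fs, Nonempty (graph n F →g G) := by
  refine exists_hom_of_hubSearch hcard hn hG hd hG' _
    (map_val_eq_labels (fun hv ↦ (hM v hv).ne rfl) hα hβ) (fun x y h ↦ ?_) (fun x y h ↦ ?_) h
  · grind [joined]
  · grind [separated, SimpleGraph.irrefl]

theorem exists_hom_of_hub_of_antitone (hcard : Fintype.card V = n) (hn : n ≤ 10)
    (hG : MinNonColorable G m) (hd : ∀ u, d ≤ G.degree u) (hG' : ∀ u, ¬ G.IsUniversal u)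
    (hc : ∀ x ≠ v, ∀ y ≠ v, G.Adj x y → c x ≠ c y) (hM : ∀ x ∈ M, G.Adj v x)
    (hfull : full → ∀ x, G.Adj v x → x ∈ M) (hα : ∀ i, (M.filter (c · = i)).card = α i)
    (hβ : ∀ i, ((insert v M)ᶜ.filter (c · = i)).card = β i)
    (h : ∀ σ : Equiv.Perm (Fin m), Antitone (β ∘ σ) → hubSearch Fs d n full (α ∘ σ) (β ∘ σ)) :
    ∃ F ∈ Fs, Nonempty (graph n F →g G) := by
  let σ := Tuple.sort (OrderDual.toDual ∘ β)
  refine exists_hom_of_hub (c := σ.symm ∘ c) hcard hn hG hd hG'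
    (fun x hx y hy hxy ↦ σ.symm.injective.ne (hc x hx y hy hxy)) hM hfull (fun i ↦ ?_) (fun i ↦ ?_)
    (h σ (Tuple.monotone_sort (OrderDual.toDual ∘ β)))
  · simp only [Function.comp_apply, Equiv.symm_apply_eq]
    exact hα (σ i)
  · simp only [Function.comp_apply, Equiv.symm_apply_eq]
    exact hβ (σ i)

theorem exists_hom_of_forall_hubSearch [NeZero m] (hcard : Fintype.card V = n) (hn : n ≤ 10)
    (hG : MinNonColorable G m) (hG' : ∀ u, ¬ G.IsUniversal u)
    (h : ∀ β : Fin m → ℕ, Antitone β → m + ∑ i, β i + 1 = n →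
      hubSearch Fs m n true 1 β ∧ hubSearch Fs (m + 1) n false 1 β) :
    ∃ F ∈ Fs, Nonempty (graph n F →g G) := by
  have hdegree (u : V) : m ≤ G.degree u := by
    obtain ⟨c, hc⟩ := (hG.erase_vertex u).exists_fin_coloring
    exact hG.le_degree hc
  obtain ⟨v, d, hd, full, hd', hfull⟩ : ∃ v d, (∀ u, d ≤ G.degree u) ∧ ∃ full : Bool,
      (d = bif full then m else m + 1) ∧ (full → G.degree v = m) := by
    by_cases hv : ∃ v, G.degree v = m
    · obtain ⟨v, hv⟩ := hv
      exact ⟨v, m, hdegree, true, rfl, fun _ ↦ hv⟩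
    · obtain ⟨v⟩ := hG.nonempty
      push Not at hv
      exact ⟨v, m + 1, fun u ↦ (hdegree u).lt_of_ne' (hv u), false, rfl, by simp⟩
  obtain ⟨c, hc⟩ := (hG.erase_vertex v).exists_fin_coloring
  choose g hvg hcg using hG.exists_adj_of_coloring hc
  have hginj : Function.Injective g := Function.LeftInverse.injective hcg
  have hM : ∀ x ∈ Finset.univ.image g, G.Adj v x := by simpa using hvg
  have hMcard : (Finset.univ.image g).card = m := by
    rw [Finset.card_image_of_injective _ hginj, Finset.card_fin]
  refine exists_hom_of_hub_of_antitone (full := full) (α := 1) hcard hn hG hd hG' hc hM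
    (fun hf x hx ↦ ?_) (fun i ↦ Finset.card_eq_one.2 ⟨g i, by grind⟩) (fun i ↦ rfl) fun σ hσ ↦ ?_
  · have hM' := Finset.eq_of_subset_of_card_le (t := G.neighborFinset v)
      (fun x hx ↦ by simpa using hM x hx)
      (by rw [hMcard, SimpleGraph.card_neighborFinset_eq_degree, hfull hf])
    rw [hM', SimpleGraph.mem_neighborFinset]
    exact hx
  · have hsum : m + ∑ i, (((insert v (Finset.univ.image g))ᶜ.filter (c · = i)).card) + 1 = n := by
      rw [← Finset.card_eq_sum_card_fiberwise fun _ _ ↦ Finset.mem_univ _, Finset.card_compl,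
        Finset.card_insert_of_notMem fun hv ↦ (hM v hv).ne rfl, hMcard, hcard]
      have := Finset.card_le_univ (insert v (Finset.univ.image g))
      rw [Finset.card_insert_of_notMem fun hv ↦ (hM v hv).ne rfl, hMcard, hcard] at this
      lia
    have := h _ hσ (by rw [← hsum, ← Equiv.sum_comp σ fun i ↦ Finset.card _]; rfl)
    cases full
    · exact hd' ▸ this.2
    · exact hd' ▸ this.1

theorem exists_hom_of_hasCoMatching_erase [NeZero m] (hcard : Fintype.card V = 2 * m + 1)
    (hn : 2 * m + 1 ≤ 10) (hG : MinNonColorable G m) (hd : ∀ u, d ≤ G.degree u)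
    (hG' : ∀ u, ¬ G.IsUniversal u) (hmatch : HasCoMatching G (Finset.univ.erase v))
    (h : ∀ β : Fin m → ℕ, Antitone β → (∀ i, β i ≤ 1) → ∑ i, β i + G.degree v = 2 * m →
      hubSearch Fs d (2 * m + 1) true (2 - β) β) :
    ∃ F ∈ Fs, Nonempty (graph (2 * m + 1) F →g G) := by
  obtain ⟨c, hc, hclass⟩ := hG.exists_coloring_card_eq_two hcard hmatch
  have hpos (i : Fin m) : 0 < ((G.neighborFinset v).filter (c · = i)).card := by
    obtain ⟨x, hvx, hx⟩ := hG.exists_adj_of_coloring hc i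
    exact Finset.card_pos.2 ⟨x, by simpa using ⟨hvx, hx⟩⟩
  have hsplit (i : Fin m) : ((G.neighborFinset v).filter (c · = i)).card +
      ((insert v (G.neighborFinset v))ᶜ.filter (c · = i)).card = 2 := by
    rw [← hclass i, ← Finset.card_union_of_disjoint]
    · congr 1
      ext x
      have := G.ne_of_adj (a := v) (b := x)
      grind [SimpleGraph.mem_neighborFinset, Finset.mem_compl]
    · exact Finset.disjoint_left.2 fun x hx hx' ↦ by grind [Finset.mem_compl]
  have hsum : ∑ i, ((G.neighborFinset v).filter (c · = i)).card = G.degree v := by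
    rw [← Finset.card_eq_sum_card_fiberwise fun _ _ ↦ Finset.mem_univ _,
      SimpleGraph.card_neighborFinset_eq_degree]
  refine exists_hom_of_hub_of_antitone (full := true) (M := G.neighborFinset v) hcard hn hG hd hG'
    hc (fun x ↦ (G.mem_neighborFinset v x).1) (fun _ x ↦ (G.mem_neighborFinset v x).2)
    (fun i ↦ (Nat.sub_eq_of_eq_add (hsplit i).symm).symm) (fun i ↦ rfl) fun σ hσ ↦ ?_
  refine h _ hσ (fun i ↦ ?_) ?_
  · have := hpos (σ i)
    have := hsplit (σ i)
    lia
  · have := Finset.sum_congr rfl fun i (_ : i ∈ Finset.univ) ↦ hsplit i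
    rw [Finset.sum_add_distrib, hsum, Finset.sum_const, Finset.card_fin] at this
    rw [← Equiv.sum_comp σ fun i ↦ (Finset.filter _ (insert v _)ᶜ).card, smul_eq_mul] at this
    lia

theorem exists_hom_of_forall_hasCoMatching (hcard : Fintype.card V = 9) (hG : MinNonColorable G 4)
    (hG' : ∀ u, ¬ G.IsUniversal u) (hmatch : ∀ v, HasCoMatching G (Finset.univ.erase v))
    (h₄ : hubSearch Fs 4 9 true (1 : Fin 4 → ℕ) 1)
    (h₆ : hubSearch Fs 5 9 true ![1, 1, 2, 2] ![1, 1, 0, 0]) :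
    ∃ F ∈ Fs, Nonempty (graph 9 F →g G) := by
  have hdegree (u : V) : 4 ≤ G.degree u := by
    obtain ⟨c, hc⟩ := (hG.erase_vertex u).exists_fin_coloring
    exact hG.le_degree hc
  by_cases hv : ∃ v, G.degree v = 4
  · obtain ⟨v, hv⟩ := hv
    refine exists_hom_of_hasCoMatching_erase hcard (by norm_num) hG hdegree hG' (hmatch v)
      fun β _ hβ hsum ↦ ?_
    obtain rfl : β = 1 := by
      simp only [Fin.sum_univ_four, hv] at hsum
      ext i
      have := hβ 0; have := hβ 1; have := hβ 2; have := hβ 3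
      fin_cases i <;> simp <;> lia
    exact h₄
  · push Not at hv
    have hd (u : V) : 5 ≤ G.degree u := (hdegree u).lt_of_ne' (hv u)
    obtain ⟨v, hv⟩ : ∃ v, G.degree v = 6 := by
      by_contra! h6
      have hodd : Finset.univ.filter (fun u ↦ Odd (G.degree u)) = Finset.univ := by
        refine Finset.filter_true_of_mem fun u _ ↦ ?_
        have hlt := (G.degree_lt_card_sub_one u).2 (hG' u)
        have := hd u
        have := h6 u
        grind
      have := G.even_card_odd_degree_vertices
      rw [hodd, Finset.card_univ, hcard] at this
      exact absurd this (by decide)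
    refine exists_hom_of_hasCoMatching_erase hcard (by norm_num) hG hd hG' (hmatch v)
      fun β hβ hβ' hsum ↦ ?_
    obtain rfl : β = ![1, 1, 0, 0] := by
      simp only [Fin.sum_univ_four, hv] at hsum
      have := hβ (show (0 : Fin 4) ≤ 1 by decide)
      have := hβ (show (1 : Fin 4) ≤ 2 by decide)
      have := hβ (show (2 : Fin 4) ≤ 3 by decide)
      have := hβ' 0; have := hβ' 1; have := hβ' 2
      ext i
      fin_cases i <;> simp <;> lia
    have hα : (2 : Fin 4 → ℕ) - ![1, 1, 0, 0] = ![1, 1, 2, 2] := by decide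
    rwa [hα]

end Hub
end Table

section Triangles

variable {V W : Type*} [Fintype V] [Fintype W] {G : SimpleGraph V} {H : SimpleGraph W}
  [DecidableRel G.Adj] [DecidableRel H.Adj]

/-- The sum of the squares of the numbers of ordered triangles at the vertices of `G`, an invariant
that tells the graphs of `Table.cores` with the same number of vertices apart. -/
def triangleInvariant (G : SimpleGraph V) [DecidableRel G.Adj] : ℕ :=
  ∑ v, (Finset.univ.filter fun p : V × V ↦ G.Adj v p.1 ∧ G.Adj v p.2 ∧ G.Adj p.1 p.2).card ^ 2

theorem AreIso.triangleInvariant_eq (h : AreIso G H) :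
    triangleInvariant G = triangleInvariant H := by
  obtain ⟨f⟩ := h
  refine Fintype.sum_equiv f.toEquiv _ _ fun v ↦ congrArg (· ^ 2) ?_
  exact Finset.card_equiv (f.toEquiv.prodCongr f.toEquiv) fun p ↦ by simp [f.map_adj_iff]

end Triangles

namespace Table

instance (n : ℕ) (N : Table) : DecidableRel (graph n N).Adj :=
  fun _ _ ↦ inferInstanceAs (Decidable (_ ∧ _))

/-- The classes of an `m`-colouring of the graph with the table `N` without the edge `uv`, if there
is one. All pairs are taken to be cheap, so that the search stops at the first colouring. -/
def edgeColoring (N : Table) (m n u v : ℕ) : List ℕ :=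
  List.tail (bestColoring (Nat.xor N (edge u v)) (2 ^ 100 - 1) (List.range n) m 0 [] [])

/-- A decidable criterion for `graph n N` to be minimal among the graphs that are not
`m`-colourable: the removal of an edge `uv` makes `u` and `v` the only adjacent vertices in a common
class of a partition into `m` classes. -/
def HasCertificate (N : Table) (m n : ℕ) : Prop :=
  (∀ a b : Fin n, (row N a).testBit b → (graph n N).Adj a b) ∧
  colorable (ofRel (fun u v ↦ (row N u).testBit v) n) m (List.range n) = false ∧
  (∀ a : Fin n, ∃ b, (graph n N).Adj a b) ∧
  ∀ a b : Fin n, (graph n N).Adj a b →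
    isCover m (List.range n) (edgeColoring N m n a b) ∧
    ∀ p ∈ openPairs (ofRel (fun u v ↦ !(row N u).testBit v) n) (edgeColoring N m n a b)
      (List.range n), p = (a.1, b.1) ∨ p = (b.1, a.1)

instance (N : Table) (m n : ℕ) : Decidable (HasCertificate N m n) :=
  inferInstanceAs (Decidable (_ ∧ _ ∧ _ ∧ _))

theorem HasCertificate.minNonColorable {N : Table} {m n : ℕ} (h : HasCertificate N m n)
    (hn : n ≤ 10) : MinNonColorable (graph n N) m := by
  obtain ⟨hadj, hcolor, hdegree, hedge⟩ := h
  have hN : Entries (ofRel (fun u v ↦ (row N u).testBit v) n) (graph n N).Adj :=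
    entries_ofRel hn fun a b hab ↦ ⟨hadj a b hab, (hadj a b hab).symm⟩
  refine .of_erase_edge (hN.not_colorable (fun _ ↦ List.mem_range.1) hcolor) hdegree
    fun a b hab ↦ ?_
  obtain ⟨hcover, hopen⟩ := hedge a b hab
  have hK : Entries (ofRel (fun u v ↦ !(row N u).testBit v) n) fun c d ↦
      ¬ ((graph n N).deleteEdges {s(a, b)}).Adj c d := entries_ofRel hn fun c d hcd ↦ by
    have hcd : ¬ (graph n N).Adj c d := fun h ↦ by simp [h.2.1] at hcd
    exact ⟨fun h ↦ hcd (SimpleGraph.deleteEdges_le _ h),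
      fun h ↦ hcd (SimpleGraph.deleteEdges_le _ h).symm⟩
  refine colorable_of_openPairs hn hcover hK fun c d hcd ↦ ?_
  rw [deleteEdges_singleton_adj]
  have := hopen _ hcd
  simp only [Prod.mk.injEq, ← Fin.ext_iff] at this
  tauto

/-- The 5-cycle. -/
def cycle5 : Table :=
  ofEdges [1, 4, 12, 23, 34]

/-- The 7-cycle. -/
def cycle7 : Table :=
  ofEdges [1, 6, 12, 23, 34, 45, 56]

/-- The 4-critical graphs with 8 vertices and no universal vertex. -/
def graphs8 : List Table :=
  [ofEdges [1, 2, 7, 12, 14, 23, 35, 36, 45, 46, 56, 57, 67],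
   ofEdges [1, 4, 6, 12, 17, 23, 25, 35, 36, 45, 46, 56, 57, 67],
   ofEdges [1, 4, 6, 12, 16, 23, 25, 35, 37, 45, 46, 56, 57, 67],
   ofEdges [1, 3, 5, 12, 14, 25, 26, 34, 36, 46, 47, 56, 57, 67]]

/-- The 5-critical graphs with 9 vertices and no universal vertex. -/
def graphs9 : List Table :=
  [ofEdges [1, 2, 3, 6, 12, 13, 16, 23, 24, 34, 45, 47, 48, 56, 57, 58, 67, 68, 78],
   ofEdges [1, 2, 3, 8, 12, 13, 18, 23, 28, 34, 45, 46, 47, 56, 57, 58, 67, 68, 78],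
   ofEdges [1, 2, 5, 8, 12, 15, 18, 23, 24, 34, 36, 37, 46, 47, 56, 57, 58, 67, 68, 78],
   ofEdges [1, 2, 3, 7, 12, 14, 16, 26, 27, 35, 37, 38, 45, 46, 48, 56, 57, 58, 67, 68, 78],
   ofEdges [1, 2, 5, 8, 12, 14, 18, 23, 25, 34, 36, 37, 46, 47, 48, 56, 57, 58, 67, 68, 78],
   ofEdges [1, 2, 3, 6, 12, 13, 16, 24, 27, 34, 35, 38, 45, 47, 48, 56, 57, 58, 67, 68, 78],
   ofEdges [1, 2, 6, 7, 12, 13, 14, 23, 27, 34, 35, 38, 45, 46, 48, 56, 57, 58, 67, 68, 78],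
   ofEdges [1, 2, 7, 8, 12, 17, 18, 23, 24, 35, 36, 38, 45, 46, 47, 56, 57, 58, 67, 68, 78],
   ofEdges [1, 2, 3, 4, 12, 14, 16, 17, 23, 26, 28, 34, 35, 38, 45, 47, 56, 57, 58, 67, 68, 78],
   ofEdges [1, 2, 7, 8, 13, 15, 18, 23, 26, 28, 34, 35, 36, 45, 46, 47, 56, 57, 58, 67, 68, 78],
   ofEdges [1, 6, 7, 8, 12, 14, 16, 23, 25, 27, 34, 35, 38, 45, 46, 48, 56, 57, 58, 67, 68, 78],
   ofEdges [1, 6, 7, 8, 12, 13, 14, 25, 27, 28, 35, 36, 38, 45, 46, 47, 56, 57, 58, 67, 68, 78],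
   ofEdges [1, 6, 7, 8, 12, 14, 16, 23, 25, 27, 35, 37, 38, 45, 46, 48, 56, 57, 58, 67, 68, 78],
   ofEdges [1, 2, 7, 8, 15, 17, 18, 23, 26, 28, 34, 35, 36, 45, 46, 47, 56, 57, 58, 67, 68, 78],
   ofEdges [1, 3, 4, 8, 12, 15, 16, 23, 24, 27, 36, 37, 38, 45, 47, 48, 56, 57, 58, 67, 68, 78],
   ofEdges [1, 2, 3, 7, 13, 15, 17, 23, 26, 27, 34, 35, 36, 45, 46, 48, 56, 57, 58, 67, 68, 78]]

/-- The join of two 5-cycles. -/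
def doubleCycle5 : Table :=
  ofEdges [1, 4, 5, 6, 7, 8, 9, 12, 15, 16, 17, 18, 19, 23, 25, 26, 27, 28, 29, 34, 35, 36, 37,
    38, 39, 45, 46, 47, 48, 49, 56, 59, 67, 78, 89]

theorem minNonColorable_cycle5 : MinNonColorable (graph 5 cycle5) 2 :=
  HasCertificate.minNonColorable (by decide +kernel) (by norm_num)

/-- The listed graphs together with one less than their chromatic numbers `m + 1`; they have `m + 5`
vertices. -/
def cores : Finset (ℕ × Table) :=
  ((2, cycle7) :: graphs8.map (3, ·) ++ graphs9.map (4, ·) ++ [(5, doubleCycle5)]).toFinset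

theorem hasCertificate_of_mem_cores : ∀ p ∈ cores, HasCertificate p.2 p.1 (p.1 + 5) := by
  decide +kernel

theorem card_cores : cores.card = 22 := by decide +kernel

theorem le_five_of_mem_cores : ∀ p ∈ cores, p.1 ≤ 5 := by decide +kernel

theorem exists_not_adj_of_mem_cores :
    ∀ p ∈ cores, ∀ a, ∃ b, a ≠ b ∧ ¬ (graph (p.1 + 5) p.2).Adj a b := by
  decide +kernel

theorem injOn_triangleInvariant_cores : ∀ p ∈ cores, ∀ q ∈ cores, p.1 = q.1 →
    triangleInvariant (graph (p.1 + 5) p.2) = triangleInvariant (graph (q.1 + 5) q.2) → p = q := by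
  decide +kernel

theorem hubSearch_cycle5 : ∀ β₀ < 3, ∀ β₁ ≤ β₀, β₀ + β₁ = 2 →
    hubSearch [cycle5] 2 5 true 1 ![β₀, β₁] ∧ hubSearch [cycle5] 3 5 false 1 ![β₀, β₁] := by
  decide +kernel

theorem hubSearch_cycle7 : ∀ β₀ < 5, ∀ β₁ ≤ β₀, β₀ + β₁ = 4 →
    hubSearch [cycle7] 2 7 true 1 ![β₀, β₁] ∧ hubSearch [cycle7] 3 7 false 1 ![β₀, β₁] := by
  decide +kernel

theorem hubSearch_graphs8 : ∀ β₀ < 5, ∀ β₁ ≤ β₀, ∀ β₂ ≤ β₁, β₀ + β₁ + β₂ = 4 →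
    hubSearch graphs8 3 8 true 1 ![β₀, β₁, β₂] ∧ hubSearch graphs8 4 8 false 1 ![β₀, β₁, β₂] := by
  decide +kernel

theorem hubSearch_graphs9_four : hubSearch graphs9 4 9 true 1 (1 : Fin 4 → ℕ) := by
  decide +kernel

theorem hubSearch_graphs9_five : hubSearch graphs9 5 9 true ![1, 1, 2, 2] ![1, 1, 0, 0] := by
  decide +kernel

end Table

section Classification

variable {V : Type*} {G : SimpleGraph V} {m : ℕ}

theorem MinNonColorable.exists_induce_of_not_preconnected_compl (h : MinNonColorable G m)
    (hG : ∀ v, ¬ G.IsUniversal v) (hconn : ¬ Gᶜ.Preconnected) :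
    ∃ (X : Set V) (a b : ℕ), a + b + 1 = m ∧ G.IsCompleteBetween X Xᶜ ∧
      (MinNonColorable (G.induce X) a ∧ ∀ v, ¬ (G.induce X).IsUniversal v) ∧
      (MinNonColorable (G.induce Xᶜ) b ∧ ∀ v, ¬ (G.induce Xᶜ).IsUniversal v) := by
  obtain ⟨X, hX, hX', hjoin⟩ := exists_isCompleteBetween_of_not_preconnected_compl hconn
  obtain ⟨a, b, hab, ha, hb⟩ := h.exists_induce (Set.union_compl_self X) hjoin hX hX'
  refine ⟨X, a, b, hab, hjoin, ⟨ha, fun v hv ↦ hG v fun w hvw ↦ ?_⟩,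
    ⟨hb, fun v hv ↦ hG v fun w hvw ↦ ?_⟩⟩
  · by_cases hw : w ∈ X
    · exact hv (w := ⟨w, hw⟩) (Subtype.coe_ne_coe.1 hvw)
    · exact hjoin v.2 hw
  · by_cases hw : w ∈ X
    · exact (hjoin hw v.2).symm
    · exact hv (w := ⟨w, hw⟩) (Subtype.coe_ne_coe.1 hvw)

variable [Fintype V]

theorem MinNonColorable.add_three_le_card (h : MinNonColorable G m)
    (hG : ∀ v, ¬ G.IsUniversal v) : m + 3 ≤ Fintype.card V := by
  classical
  induction hn : Fintype.card V using Nat.strong_induction_on generalizing V m with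
  | _ n ih =>
    by_cases hconn : Gᶜ.Preconnected
    · have := h.two_mul_add_one_le_card hconn
      have := h.two_le hG
      omega
    · obtain ⟨X, a, b, hab, -, ⟨ha, hGa⟩, hb, hGb⟩ :=
        h.exists_induce_of_not_preconnected_compl hG hconn
      have := set_fintype_card_le_univ X
      have := Fintype.card_compl_set X
      have := Fintype.card_pos_iff.2 ha.nonempty
      have := Fintype.card_pos_iff.2 hb.nonempty
      have := ih _ (by omega) ha hGa rfl
      have := ih _ (by omega) hb hGb rfl
      omega

theorem MinNonColorable.preconnected_compl (h : MinNonColorable G m)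
    (hG : ∀ v, ¬ G.IsUniversal v) (hcard : Fintype.card V < m + 5) : Gᶜ.Preconnected := by
  classical
  by_contra hconn
  obtain ⟨X, a, b, hab, -, ⟨ha, hGa⟩, hb, hGb⟩ :=
    h.exists_induce_of_not_preconnected_compl hG hconn
  have := set_fintype_card_le_univ X
  have := Fintype.card_compl_set X
  have := ha.add_three_le_card hGa
  have := hb.add_three_le_card hGb
  omega

namespace Table

theorem exists_areIso_of_exists_hom {n : ℕ} {Fs : List Table} (hcard : Fintype.card V = n)
    (hG : MinNonColorable G m) (hFs : ∀ F ∈ Fs, MinNonColorable (graph n F) m)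
    (h : ∃ F ∈ Fs, Nonempty (graph n F →g G)) : ∃ F ∈ Fs, AreIso G (graph n F) := by
  obtain ⟨F, hF, ⟨f⟩⟩ := h
  exact ⟨F, hF, hG.areIso_of_hom (by simpa using hcard) (hFs F hF).not_colorable f⟩

theorem minNonColorable_of_mem_cores {p : ℕ × Table} (hp : p ∈ cores) :
    MinNonColorable (graph (p.1 + 5) p.2) p.1 :=
  (hasCertificate_of_mem_cores p hp).minNonColorable (by have := le_five_of_mem_cores p hp; omega)

theorem cycle7_mem_cores : (2, cycle7) ∈ cores := by simp [cores]

theorem doubleCycle5_mem_cores : (5, doubleCycle5) ∈ cores := by simp [cores]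

theorem mem_cores_of_mem_graphs8 {F : Table} (hF : F ∈ graphs8) : (3, F) ∈ cores := by
  simp [cores, hF]

theorem mem_cores_of_mem_graphs9 {F : Table} (hF : F ∈ graphs9) : (4, F) ∈ cores := by
  simp [cores, hF]

theorem areIso_cycle5 (hG : MinNonColorable G 2) (hG' : ∀ v, ¬ G.IsUniversal v)
    (hcard : Fintype.card V = 5) : AreIso G (graph 5 cycle5) := by
  suffices ∃ F ∈ [cycle5], AreIso G (graph 5 F) by simpa using this
  refine exists_areIso_of_exists_hom hcard hG (by simpa using minNonColorable_cycle5)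
    (exists_hom_of_forall_hubSearch hcard (by norm_num) hG hG' fun β hβ hsum ↦ ?_)
  have hβ₁ := hβ (Fin.zero_le 1)
  rw [Fin.sum_univ_two] at hsum
  exact FinVec.etaExpand_eq β ▸ hubSearch_cycle5 (β 0) (by omega) (β 1) hβ₁ (by omega)

theorem areIso_cycle7 (hG : MinNonColorable G 2) (hG' : ∀ v, ¬ G.IsUniversal v)
    (hcard : Fintype.card V = 7) : AreIso G (graph 7 cycle7) := by
  suffices ∃ F ∈ [cycle7], AreIso G (graph 7 F) by simpa using this
  refine exists_areIso_of_exists_hom hcard hG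
    (by simpa using minNonColorable_of_mem_cores cycle7_mem_cores)
    (exists_hom_of_forall_hubSearch hcard (by norm_num) hG hG' fun β hβ hsum ↦ ?_)
  have hβ₁ := hβ (Fin.zero_le 1)
  rw [Fin.sum_univ_two] at hsum
  exact FinVec.etaExpand_eq β ▸ hubSearch_cycle7 (β 0) (by omega) (β 1) hβ₁ (by omega)

theorem exists_areIso_graphs8 (hG : MinNonColorable G 3) (hG' : ∀ v, ¬ G.IsUniversal v)
    (hcard : Fintype.card V = 8) : ∃ F ∈ graphs8, AreIso G (graph 8 F) := by
  refine exists_areIso_of_exists_hom hcard hG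
    (fun _ hF ↦ minNonColorable_of_mem_cores (mem_cores_of_mem_graphs8 hF))
    (exists_hom_of_forall_hubSearch hcard (by norm_num) hG hG' fun β hβ hsum ↦ ?_)
  have hβ₁ := hβ (Fin.zero_le 1)
  have hβ₂ := hβ (show (1 : Fin 3) ≤ 2 by decide)
  rw [Fin.sum_univ_three] at hsum
  exact FinVec.etaExpand_eq β ▸ hubSearch_graphs8 (β 0) (by omega) (β 1) hβ₁ (β 2) hβ₂ (by omega)

theorem exists_areIso_graphs9 (hG : MinNonColorable G 4) (hG' : ∀ v, ¬ G.IsUniversal v)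
    (hconn : Gᶜ.Preconnected) (hcard : Fintype.card V = 9) :
    ∃ F ∈ graphs9, AreIso G (graph 9 F) :=
  exists_areIso_of_exists_hom hcard hG
    (fun _ hF ↦ minNonColorable_of_mem_cores (mem_cores_of_mem_graphs9 hF))
    (exists_hom_of_forall_hasCoMatching hcard hG hG' (hG.hasCoMatching_erase hconn hcard.le)
      hubSearch_graphs9_four hubSearch_graphs9_five)

theorem areIso_graphJoin_cycle5 :
    AreIso (graphJoin (graph 5 cycle5) (graph 5 cycle5)) (graph 10 doubleCycle5) := by
  refine ⟨⟨finSumFinEquiv, ?_⟩⟩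
  rintro (a | a) (b | b)
  all_goals
    simp only [graphJoin_adj_inl_inl, graphJoin_adj_inl_inr, graphJoin_adj_inr_inl,
      graphJoin_adj_inr_inr, iff_true]
    revert a b
    decide +kernel

theorem eq_two_and_areIso_cycle5 (hG : MinNonColorable G m) (hG' : ∀ v, ¬ G.IsUniversal v)
    (hcard : Fintype.card V = m + 3) : m = 2 ∧ AreIso G (graph 5 cycle5) := by
  have := hG.two_mul_add_one_le_card (hG.preconnected_compl hG' (by omega))
  obtain rfl : m = 2 := by have := hG.two_le hG'; omega
  exact ⟨rfl, areIso_cycle5 hG hG' hcard⟩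

theorem eq_five_and_areIso_doubleCycle5 (hG : MinNonColorable G m)
    (hG' : ∀ v, ¬ G.IsUniversal v) (hcard : Fintype.card V = m + 5)
    (hconn : ¬ Gᶜ.Preconnected) : m = 5 ∧ AreIso G (graph 10 doubleCycle5) := by
  classical
  obtain ⟨X, a, b, rfl, hjoin, ⟨ha, hGa⟩, hb, hGb⟩ :=
    hG.exists_induce_of_not_preconnected_compl hG' hconn
  have := Fintype.card_compl_set X
  have := ha.add_three_le_card hGa
  have := hb.add_three_le_card hGb
  obtain ⟨rfl, hXa⟩ := eq_two_and_areIso_cycle5 ha hGa (by omega)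
  obtain ⟨rfl, hXb⟩ := eq_two_and_areIso_cycle5 hb hGb (by omega)
  exact ⟨rfl, (areIso_graphJoin_induce hjoin).symm.trans
    ((hXa.graphJoin hXb).trans areIso_graphJoin_cycle5)⟩

theorem exists_mem_cores_areIso (hG : MinNonColorable G m) (hG' : ∀ v, ¬ G.IsUniversal v)
    (hcard : Fintype.card V = m + 5) : ∃ F, (m, F) ∈ cores ∧ AreIso G (graph (m + 5) F) := by
  by_cases hconn : Gᶜ.Preconnected
  · have := hG.two_mul_add_one_le_card hconn
    obtain rfl | rfl | rfl : m = 2 ∨ m = 3 ∨ m = 4 := by have := hG.two_le hG'; omega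
    · exact ⟨cycle7, cycle7_mem_cores, areIso_cycle7 hG hG' hcard⟩
    · obtain ⟨F, hF, hGF⟩ := exists_areIso_graphs8 hG hG' hcard
      exact ⟨F, mem_cores_of_mem_graphs8 hF, hGF⟩
    · obtain ⟨F, hF, hGF⟩ := exists_areIso_graphs9 hG hG' hconn hcard
      exact ⟨F, mem_cores_of_mem_graphs9 hF, hGF⟩
  · obtain ⟨rfl, hGF⟩ := eq_five_and_areIso_doubleCycle5 hG hG' hcard hconn
    exact ⟨doubleCycle5, doubleCycle5_mem_cores, hGF⟩

end Table

end Classification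

theorem numCritical_eq_card {ι : Type*} [Fintype ι] {V : ι → Type*} [∀ i, Fintype (V i)]
    {r n : ℕ} (H : ∀ i, SimpleGraph (V i)) (hcard : ∀ i, Fintype.card (V i) = n)
    (hinj : ∀ i j, AreIso (H i) (H j) → i = j)
    (h : ∀ G : SimpleGraph (Fin n), IsCritical r G ↔ ∃ i, AreIso G (H i)) :
    numCritical r n = Fintype.card ι := by
  let H' (i : ι) : SimpleGraph (Fin n) := (H i).overFin (hcard i)
  have hH' (i : ι) : AreIso (H' i) (H i) := AreIso.symm ⟨(H i).overFinIso (hcard i)⟩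
  have hrange : {q : Quotient (isoSetoid n) | ∃ G : SimpleGraph (Fin n),
      IsCritical r G ∧ Quotient.mk (isoSetoid n) G = q} =
      Set.range fun i ↦ Quotient.mk (isoSetoid n) (H' i) := by
    ext q
    constructor
    · rintro ⟨G, hG, rfl⟩
      obtain ⟨i, hi⟩ := (h G).1 hG
      exact ⟨i, Quotient.sound ((hH' i).trans hi.symm)⟩
    · rintro ⟨i, rfl⟩
      exact ⟨H' i, (h _).2 ⟨i, hH' i⟩, rfl⟩
  rw [numCritical, hrange, ← Set.image_univ, Set.ncard_image_of_injective, Set.ncard_univ,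
    Nat.card_eq_fintype_card]
  exact fun i j hij ↦ hinj i j ((hH' i).symm.trans ((Quotient.exact hij).trans (hH' j)))

namespace Table

theorem length_graphs8 : graphs8.length = 4 := rfl

theorem length_graphs9 : graphs9.length = 16 := rfl

theorem nodup_graphs8 : graphs8.Nodup := by decide +kernel

theorem nodup_graphs9 : graphs9.Nodup := by decide +kernel

theorem not_isUniversal_of_mem_cores {p : ℕ × Table} (hp : p ∈ cores) (v : Fin (p.1 + 5)) :
    ¬ (graph (p.1 + 5) p.2).IsUniversal v := by
  obtain ⟨w, hvw, hadj⟩ := exists_not_adj_of_mem_cores p hp v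
  exact fun hv ↦ hadj (hv hvw)

theorem eq_of_areIso_graph {p q : ℕ × Table} (hp : p ∈ cores) (hq : q ∈ cores)
    (h : AreIso (graph (p.1 + 5) p.2) (graph (q.1 + 5) q.2)) : p = q := by
  obtain ⟨f⟩ := id h
  have hcard := Fintype.card_congr f.toEquiv
  rw [Fintype.card_fin, Fintype.card_fin, Nat.add_right_cancel_iff] at hcard
  exact injOn_triangleInvariant_cores p hp q hq hcard h.triangleInvariant_eq

theorem minNonColorable_iff_exists_mem_cores {V : Type*} [Fintype V] {G : SimpleGraph V} {m : ℕ}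
    (hcard : Fintype.card V = m + 5) : MinNonColorable G m ↔
      ∃ p ∈ cores, p.1 ≤ m ∧ AreIso G (addSimplicial (graph (p.1 + 5) p.2) (m - p.1)) := by
  constructor
  · intro hG
    obtain ⟨k, s, rfl, hcore, hiso⟩ := hG.exists_core (by omega)
    classical
    have hV := Fintype.card_congr hiso.some.toEquiv
    rw [Fintype.card_sum, Fintype.card_fin] at hV
    obtain ⟨F, hF, hGF⟩ := exists_mem_cores_areIso hcore not_isUniversal_core (by omega)
    refine ⟨(k, F), hF, Nat.le_add_right k s, ?_⟩
    rw [Nat.add_sub_cancel_left]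
    exact hiso.trans (hGF.addSimplicial s)
  · rintro ⟨p, hp, hpm, hiso⟩
    have h := (minNonColorable_of_mem_cores hp).addSimplicial (m - p.1)
    rw [Nat.add_sub_cancel' hpm] at h
    exact hiso.symm.minNonColorable h

theorem numCritical_eq_card_filter_cores (m : ℕ) :
    numCritical (m + 1) (m + 5) = (cores.filter (·.1 ≤ m)).card := by
  have hmem (p : {p // p ∈ cores.filter (·.1 ≤ m)}) := Finset.mem_filter.1 p.2
  rw [← Fintype.card_coe]
  refine numCritical_eq_card
    (fun p : {p // p ∈ cores.filter (·.1 ≤ m)} ↦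
      addSimplicial (graph (p.1.1 + 5) p.1.2) (m - p.1.1))
    (fun p ↦ ?_) (fun p q h ↦ ?_) fun G ↦ ?_
  · have := (hmem p).2
    rw [Fintype.card_sum, Fintype.card_fin, Fintype.card_fin]
    omega
  · exact Subtype.ext (eq_of_areIso_graph (hmem p).1 (hmem q).1
      (h.of_addSimplicial (not_isUniversal_of_mem_cores (hmem p).1)
        (not_isUniversal_of_mem_cores (hmem q).1)))
  · rw [isCritical_succ_iff, minNonColorable_iff_exists_mem_cores (Fintype.card_fin _)]
    simp only [Subtype.exists, Finset.mem_filter, and_assoc, exists_prop]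

theorem numCritical_of_le {r : ℕ} (hr : 6 ≤ r) : numCritical r (r + 4) = 22 := by
  obtain ⟨m, rfl⟩ := Nat.exists_eq_add_of_le' (show 1 ≤ r by omega)
  have hfilter : cores.filter (·.1 ≤ m) = cores := Finset.filter_true_of_mem fun p hp ↦ by
    have := le_five_of_mem_cores p hp
    omega
  rw [add_assoc, numCritical_eq_card_filter_cores, hfilter, card_cores]

theorem exists_mem_cores_iff {P : ℕ × Table → Prop} : (∃ p ∈ cores, P p) ↔
    P (2, cycle7) ∨ (∃ F ∈ graphs8, P (3, F)) ∨ (∃ F ∈ graphs9, P (4, F)) ∨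
      P (5, doubleCycle5) := by
  simp only [cores, List.mem_toFinset, List.mem_append, List.mem_cons, List.mem_map,
    List.not_mem_nil, or_false, or_and_right, exists_or, exists_eq_left, or_assoc,
    exists_exists_and_eq_and]

theorem isCritical_iff {V : Type*} [Fintype V] {G : SimpleGraph V} {r : ℕ} (hr : r ≠ 0)
    (hcard : Fintype.card V = r + 4) : IsCritical r G ↔
      3 ≤ r ∧ AreIso G (addSimplicial (graph 7 cycle7) (r - 3)) ∨
      (∃ F ∈ graphs8, 4 ≤ r ∧ AreIso G (addSimplicial (graph 8 F) (r - 4))) ∨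
      (∃ F ∈ graphs9, 5 ≤ r ∧ AreIso G (addSimplicial (graph 9 F) (r - 5))) ∨
      6 ≤ r ∧ AreIso G (addSimplicial (graph 10 doubleCycle5) (r - 6)) := by
  obtain ⟨m, rfl⟩ := Nat.exists_eq_succ_of_ne_zero hr
  rw [Nat.succ_eq_add_one, isCritical_succ_iff, minNonColorable_iff_exists_mem_cores hcard,
    exists_mem_cores_iff]
  simp only [Nat.reduceLeDiff, Nat.reduceAdd]
  rfl

theorem isCritical_graph {m : ℕ} {F : Table} (hF : (m, F) ∈ cores) :
    IsCritical (m + 1) (graph (m + 5) F) :=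
  isCritical_succ_iff.2 (minNonColorable_of_mem_cores hF)

end Table

theorem exists_injective_mem_iff_of_nodup {α : Type*} {l : List α} (hl : l.Nodup) {n : ℕ}
    (hn : l.length = n) : ∃ f : Fin n → α, f.Injective ∧ ∀ a, a ∈ l ↔ ∃ i, f i = a := by
  subst hn
  exact ⟨l.get, List.nodup_iff_injective_get.1 hl, fun _ ↦ List.mem_iff_get⟩

open Table

theorem mainTheorem7 :
    (∀ r : ℕ, 6 ≤ r → numCritical r (r + 4) = 22) ∧
    ∃ (A : SimpleGraph (Fin 7)) (B : Fin 4 → SimpleGraph (Fin 8))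
      (C : Fin 16 → SimpleGraph (Fin 9)) (D : SimpleGraph (Fin 10)),
      (IsCritical 3 A ∧ ∀ H : SimpleGraph (Fin 7), IsCritical 3 H → AreIso H A) ∧
      ((∀ i, IsCritical 4 (B i)) ∧ ∀ i j, AreIso (B i) (B j) → i = j) ∧
      ((∀ i, IsCritical 5 (C i)) ∧ ∀ i j, AreIso (C i) (C j) → i = j) ∧
      IsCritical 6 D ∧
      ∀ r : ℕ, 6 ≤ r → ∀ G : SimpleGraph (Fin (r + 4)),
        IsCritical r G ↔
          AreIso G (addSimplicial A (r - 3)) ∨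
          (∃ i, AreIso G (addSimplicial (B i) (r - 4))) ∨
          (∃ i, AreIso G (addSimplicial (C i) (r - 5))) ∨
          AreIso G (addSimplicial D (r - 6)) := by
  obtain ⟨B, hBinj, hB⟩ := exists_injective_mem_iff_of_nodup nodup_graphs8 length_graphs8
  obtain ⟨C, hCinj, hC⟩ := exists_injective_mem_iff_of_nodup nodup_graphs9 length_graphs9
  have hB' (i : Fin 4) := mem_cores_of_mem_graphs8 ((hB _).2 ⟨i, rfl⟩)
  have hC' (i : Fin 16) := mem_cores_of_mem_graphs9 ((hC _).2 ⟨i, rfl⟩)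
  refine ⟨fun r ↦ numCritical_of_le, graph 7 cycle7, fun i ↦ graph 8 (B i),
    fun i ↦ graph 9 (C i), graph 10 doubleCycle5,
    ⟨isCritical_graph cycle7_mem_cores, fun H hH ↦ ?_⟩,
    ⟨fun i ↦ isCritical_graph (hB' i),
      fun i j hij ↦ hBinj (congrArg Prod.snd (eq_of_areIso_graph (hB' i) (hB' j) hij))⟩,
    ⟨fun i ↦ isCritical_graph (hC' i),
      fun i j hij ↦ hCinj (congrArg Prod.snd (eq_of_areIso_graph (hC' i) (hC' j) hij))⟩,
    isCritical_graph doubleCycle5_mem_cores, fun r hr G ↦ ?_⟩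
  · have h : AreIso H (addSimplicial (graph 7 cycle7) 0) := by
      simpa using (isCritical_iff three_ne_zero (Fintype.card_fin 7)).1 hH
    exact h.trans areIso_addSimplicial_zero
  · simp only [isCritical_iff (show r ≠ 0 by omega) (Fintype.card_fin (r + 4)), hB, hC,
      exists_exists_eq_and, show 3 ≤ r by omega, show 4 ≤ r by omega, show 5 ≤ r by omega, hr,
      true_and]
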